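/- Let $n$ be a dimension and let $\mathcal P^n$ be the collection of all half-open cubes $Q=\prod_{i=1}^n[a_i,a_i+2^k)$ in $\mathbb R^n$, with $a\in\mathbb R^n$ and $k\in\mathbb Z$. Write $|Q|$ for the Lebesgue measure of $Q$, write $|E|_\mu=\mu(E)$ for a Borel measure $\mu$, and for $\Gamma>1$ let $\Gamma Q$ be the cube of the same kind concentric with $Q$ and with $\Gamma$ times its side length. For a locally finite signed Borel measure $\mu$ with total variation $|\mu|$ put $$\mathcal M\mu(x)=\sup_{Q\in\mathcal P^n,\ x\in Q}\frac{1}{|Q|}\int_Q d|\mu| .$$ For locally finite positive Borel measures $\sigma,\omega$ on $\mathbb R^n$ and $D,\Gamma>1$ define the following quantities in $[0,\infty]$ (a least constant is $\infty$ if no finite constant exists): - $\mathfrak N_{\mathcal M}(\sigma,\omega)$ is the least constant $N$ with $\int_{\mathbb R^n}\mathcal M(f\sigma)^2\,d\omega\le N^2\int_{\mathbb R^n}|f|^2\,d\sigma$ for all $f\in L^2(\sigma)$; - $\mathfrak T^D_{\mathcal M}(\Gamma)(\sigma,\omega)$ is the least constant $T$ with $\int_Q\mathcal M(\mathbf 1_Q\sigma)^2\,d\omega\le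 T^2|Q|_\sigma$ for all $Q\in\mathcal P^n$ with $|\Gamma Q|_\sigma\le D|Q|_\sigma$; - $\mathfrak T^{D,\mathrm{null}}_{\mathcal M}(\Gamma)(\sigma,\omega)$ is defined in the same way, but only with those cubes $Q$ that satisfy in addition $|\partial Q|_{\sigma+\omega}=0$; - $A_2(\sigma,\omega)=\sup_{Q\in\mathcal P^n}\frac{|Q|_\sigma}{|Q|}\,\frac{|Q|_\omega}{|Q|}$. **Theorem.** For every $n$ and every $\Gamma>1$ there are $D>1$ and $C<\infty$, depending only on $\Gamma$ and $n$, such that for all locally finite positive Borel measures $\sigma,\omega$ on $\mathbb R^n$ $$\mathfrak N_{\mathcal M}(\sigma,\omega)\le C\Big(\mathfrak T^D_{\mathcal M}(\Gamma)(\sigma,\omega)+\sqrt{A_2(\sigma,\omega)}\Big)\quad\text{and}\quad \mathfrak T^D_{\mathcal M}(\Gamma)(\sigma,\omega)+\sqrt{A_2(\sigma,\omega)}\le C\,\mathfrak N_{\mathcal M}(\sigma,\omega),$$ and, with the same $D$, also $$\mathfrak N_{\mathcal M}(\sigma,\omega)\le C\Big(\mathfrak T^{D,\mathrm{null}}_{\mathcal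 M}(\Gamma)(\sigma,\omega)+\sqrt{A_2(\sigma,\omega)}\Big)\quad\text{and}\quad \mathfrak T^{D,\mathrm{null}}_{\mathcal M}(\Gamma)(\sigma,\omega)+\sqrt{A_2(\sigma,\omega)}\le C\,\mathfrak N_{\mathcal M}(\sigma,\omega).$$ -/

import Mathlib

open MeasureTheory
open scoped ENNReal NNReal

noncomputable section

namespace RestrictedTesting

/-- The axis-parallel half-open cube in `ℝⁿ` with centre `c` and side length `s`.
The concentric dilate `ΓQ` of `Q = cube c s` is `cube c (Γ * s)`. -/
def cube {n : ℕ} (c : Fin n → ℝ) (s : ℝ) : Set (Fin n → ℝ) :=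
  {x | ∀ i, c i - s / 2 ≤ x i ∧ x i < c i + s / 2}

/-- The side length `2 ^ k`, `k ∈ ℤ`. The collection `𝒫ⁿ` consists of all cubes
`cube c (side k)` with `c ∈ ℝⁿ` and `k ∈ ℤ`. -/
def side (k : ℤ) : ℝ := (2 : ℝ) ^ k

/-- The maximal function `ℳμ(x) = sup_{Q ∈ 𝒫ⁿ, x ∈ Q} |Q|⁻¹ μ(Q)` of a positive measure `μ`. -/
def maximal {n : ℕ} (μ : Measure (Fin n → ℝ)) (x : Fin n → ℝ) : ℝ≥0∞ :=
  ⨆ (c : Fin n → ℝ) (k : ℤ) (_ : x ∈ cube c (side k)),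
    μ (cube c (side k)) / volume (cube c (side k))

/-- The total variation `|f| σ` of the (locally) signed measure `f σ`. -/
def totalVar {n : ℕ} (f : (Fin n → ℝ) → ℝ) (σ : Measure (Fin n → ℝ)) : Measure (Fin n → ℝ) :=
  σ.withDensity (fun x => ‖f x‖ₑ)

/-- The operator norm of `f ↦ ℳ(fσ)` from `L²(σ)` to `L²(ω)`: the least `N ∈ [0, ∞]` such that
`∫ ℳ(fσ)² dω ≤ N² ∫ |f|² dσ` for all `f ∈ L²(σ)`. -/
def operatorNorm {n : ℕ} (σ ω : Measure (Fin n → ℝ)) : ℝ≥0∞ :=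
  sInf {N : ℝ≥0∞ | ∀ f : (Fin n → ℝ) → ℝ, MemLp f 2 σ →
    ∫⁻ x, maximal (totalVar f σ) x ^ 2 ∂ω ≤ N ^ 2 * ∫⁻ x, ‖f x‖ₑ ^ 2 ∂σ}

/-- The `D`-`Γ`-testing constant: the least `T ∈ [0, ∞]` such that
`∫_Q ℳ(1_Q σ)² dω ≤ T² |Q|_σ` for all `Q ∈ 𝒫ⁿ` with `|ΓQ|_σ ≤ D |Q|_σ`. -/
def testing {n : ℕ} (D Γ : ℝ) (σ ω : Measure (Fin n → ℝ)) : ℝ≥0∞ :=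
  sInf {T : ℝ≥0∞ | ∀ (c : Fin n → ℝ) (k : ℤ),
    σ (cube c (Γ * side k)) ≤ ENNReal.ofReal D * σ (cube c (side k)) →
    ∫⁻ x in cube c (side k), maximal (σ.restrict (cube c (side k))) x ^ 2 ∂ω
      ≤ T ^ 2 * σ (cube c (side k))}

/-- The variant of the `D`-`Γ`-testing constant in which only those cubes `Q` are tested that
satisfy in addition `|∂Q|_{σ+ω} = 0`. -/
def testingNull {n : ℕ} (D Γ : ℝ) (σ ω : Measure (Fin n → ℝ)) : ℝ≥0∞ :=
  sInf {T : ℝ≥0∞ | ∀ (c : Fin n → ℝ) (k : ℤ),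
    (σ + ω) (frontier (cube c (side k))) = 0 →
    σ (cube c (Γ * side k)) ≤ ENNReal.ofReal D * σ (cube c (side k)) →
    ∫⁻ x in cube c (side k), maximal (σ.restrict (cube c (side k))) x ^ 2 ∂ω
      ≤ T ^ 2 * σ (cube c (side k))}

/-- The Muckenhoupt constant `A₂(σ, ω)`. -/
def muckenhoupt {n : ℕ} (σ ω : Measure (Fin n → ℝ)) : ℝ≥0∞ :=
  ⨆ (c : Fin n → ℝ) (k : ℤ),
    (σ (cube c (side k)) / volume (cube c (side k))) *
      (ω (cube c (side k)) / volume (cube c (side k)))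

end RestrictedTesting

end

/-!
The lower bounds for the operator norm `N` follow by inserting `f = 1_Q`. For the upper bound it
suffices to use the testing constant `T` over cubes with null boundary, since it is the smaller one.

The main point is that testing with the *dilated* cube on the right-hand side,
`∫_Q ℳ(1_Q σ)² dω ≤ R σ(ΓQ)`, already suffices together with `A₂`. Such an inequality is available
for every cube `Q`: if `σ(ΓQ) ≤ D σ(Q)`, it is the restricted testing condition with `R = T²`, and
otherwise the left-hand side is at most `N² σ(Q) ≤ (N² / D) σ(ΓQ)`
(`lintegral_maximalFrom_restrict_le`). So `N² ≤ c (T² + A₂ + N² / D)` with `c` depending only on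
`Γ` and `n`, and with `D = 2c` the last term is absorbed (`truncatedBound_of_half`). Absorption
needs `N` to be finite, so it is carried out for the maximal function over cubes of side at least
`2 ^ K₀` and for the restriction of `ω` to a bounded set, where finiteness of `A₂` gives an a priori
bound (`exists_truncatedBound`).

To see that dilated testing suffices, `ℳ` is dominated by the maximal functions of `2 ^ n` adjacent
dyadic grids, translated such that all testing cubes used below have null boundaries
(`exists_gridCube_superset`, `exists_translation_frontier_null`). The maximal function of a finite
family of grid cubes is linearised by disjoint sets `E_Q ⊆ Q`, and the averages are written as
`σ(ΓQ) / |Q|` times `σ(ΓQ)⁻¹ ∫_Q f dσ`. Two facts finish the argument.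

* The Carleson condition `∑_{Q ⊆ F} ω(E_Q) (σ(ΓQ) / |Q|)² ≤ B σ(ΓF)` (`carleson_condition`). Cubes
  `Q` of side comparable to that of `F` are controlled by `A₂`. Smaller ones lie in a descendant `G`
  of `F` which has a concentric cube `P` with `ΓG ⊆ P` and `ΓP ⊆ ΓF`, and dilated testing on `P`
  applies.
* The Carleson embedding theorem for averages normalised by `σ(ΓQ)` (`carleson_embedding`). A family
  of cubes with `t σ(ΓQ) < ∫_Q f dσ` has Carleson sum at most `(B / t) ∑ ∫_F f dσ`, where `F` runs
  over its maximal, hence disjoint, members, so that the overlap of the dilates is harmless.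
-/

namespace RestrictedTesting

/-! ### A Carleson embedding theorem for finite nested families -/

/-- A layer-cake comparison: a weak-type inequality between two distribution functions gives a
bound of a square integral by a first moment. -/
lemma lintegral_sq_le_of_weak {X Y : Type*} [MeasurableSpace X] [MeasurableSpace Y]
    (ρ : Measure X) (κ : Measure Y) {A : X → ℝ≥0∞} {Φ : Y → ℝ≥0∞}
    (hA : Measurable A) (hΦ : Measurable Φ) (hA' : ∀ x, A x ≠ ∞) (hΦ' : ∀ y, Φ y ≠ ∞)
    (h : ∀ t : ℝ≥0∞, t ≠ ∞ → t * ρ {x | t < A x} ≤ κ {y | t < Φ y}) :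
    ∫⁻ x, A x ^ 2 ∂ρ ≤ 2 * ∫⁻ y, Φ y ∂κ := by
  have e1 : ∫⁻ x, A x ^ 2 ∂ρ =
      ∫⁻ t in Set.Ioi (0 : ℝ), ρ {x | t < (A x).toReal} * ENNReal.ofReal (2 * t) := by
    rw [← lintegral_comp_eq_lintegral_meas_lt_mul ρ (f := fun x => (A x).toReal)
      (g := fun t => 2 * t)]
    · refine lintegral_congr fun x => ?_
      rw [intervalIntegral.integral_const_mul, integral_id]
      have : 2 * (((A x).toReal ^ 2 - 0 ^ 2) / 2) = (A x).toReal ^ 2 := by ring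
      rw [this, ENNReal.ofReal_pow ENNReal.toReal_nonneg, ENNReal.ofReal_toReal (hA' x)]
    · exact .of_forall fun x => ENNReal.toReal_nonneg
    · exact hA.ennreal_toReal.aemeasurable
    · intro t _
      exact (continuous_const.mul continuous_id).intervalIntegrable _ _
    · filter_upwards [ae_restrict_mem measurableSet_Ioi] with t ht
      exact mul_nonneg zero_le_two (le_of_lt ht)
  have e2 : ∫⁻ y, Φ y ∂κ = ∫⁻ t in Set.Ioi (0 : ℝ), κ {y | t < (Φ y).toReal} := by
    rw [← lintegral_eq_lintegral_meas_lt κ (f := fun y => (Φ y).toReal)]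
    · exact lintegral_congr fun y => (ENNReal.ofReal_toReal (hΦ' y)).symm
    · exact .of_forall fun x => ENNReal.toReal_nonneg
    · exact hΦ.ennreal_toReal.aemeasurable
  rw [e1, e2, ← lintegral_const_mul' _ _ ENNReal.ofNat_ne_top]
  refine setLIntegral_mono' measurableSet_Ioi fun t ht => ?_
  have ht : (0 : ℝ) < t := ht
  have k := h (ENNReal.ofReal t) ENNReal.ofReal_ne_top
  have s1 : {x | ENNReal.ofReal t < A x} = {x | t < (A x).toReal} := by
    ext x
    simp [ENNReal.ofReal_lt_iff_lt_toReal ht.le (hA' x)]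
  have s2 : {x | ENNReal.ofReal t < Φ x} = {x | t < (Φ x).toReal} := by
    ext x
    simp [ENNReal.ofReal_lt_iff_lt_toReal ht.le (hΦ' x)]
  rw [s1, s2] at k
  rw [ENNReal.ofReal_mul zero_le_two, ENNReal.ofReal_ofNat]
  calc _ = 2 * (ENNReal.ofReal t * ρ {x | t < (A x).toReal}) := by ring
    _ ≤ _ := by gcongr

/-- The maximal members of a finite family in which any two sets are nested or disjoint. -/
lemma exists_disjoint_cover {X ι : Type*} (s : Finset ι) (Q : ι → Set X) (le : ι → ι → Prop)
    (refl : ∀ i, le i i) (trans : ∀ i j k, le i j → le j k → le i k)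
    (lam : ∀ i j, le i j ∨ le j i ∨ Disjoint (Q i) (Q j)) :
    ∃ F ⊆ s, (F : Set ι).PairwiseDisjoint Q ∧ ∀ i ∈ s, ∃ j ∈ F, le i j := by
  classical
  induction s using Finset.induction_on with
  | empty => exact ⟨∅, by simp⟩
  | insert a s _ ih =>
    obtain ⟨F, hF, hd, hc⟩ := ih
    by_cases h : ∃ j ∈ F, le a j
    · refine ⟨F, hF.trans (Finset.subset_insert _ _), hd, fun i hi => ?_⟩
      rcases Finset.mem_insert.1 hi with rfl | hi
      exacts [h, hc i hi]
    · push Not at h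
      refine ⟨insert a (F.filter fun j => ¬ le j a),
        Finset.insert_subset_insert _ ((Finset.filter_subset _ _).trans hF), ?_, ?_⟩
      · rw [Finset.coe_insert]
        refine (hd.subset (Finset.coe_subset.2 (Finset.filter_subset _ _))).insert fun j hj _ => ?_
        have hj' := Finset.mem_filter.1 (Finset.mem_coe.1 hj)
        rcases lam a j with h1 | h1 | h1
        exacts [absurd h1 (h j hj'.1), absurd h1 hj'.2, h1]
      · intro i hi
        rcases Finset.mem_insert.1 hi with rfl | hi
        · exact ⟨i, Finset.mem_insert_self _ _, refl i⟩
        · obtain ⟨j, hj, hij⟩ := hc i hi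
          by_cases hja : le j a
          · exact ⟨a, Finset.mem_insert_self _ _, trans _ _ _ hij hja⟩
          · exact ⟨j, Finset.mem_insert_of_mem (Finset.mem_filter.2 ⟨hj, hja⟩), hij⟩

/-- The two weak-type inequalities behind the Carleson embedding: if every member of a nested
family `s` has average `> t` (measured against the enlarged size `sz`), both the Carleson sum over
`s` and the `σ`-measure of the union of `s` are controlled by the integral of `g` there. -/
lemma weak_type_of_nested {X ι : Type*} [MeasurableSpace X] (σ : Measure X) (g : X → ℝ≥0∞)
    (s : Finset ι) (Q : ι → Set X) (hQ : ∀ i, MeasurableSet (Q i)) (le : ι → ι → Prop)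
    (refl : ∀ i, le i i) (trans : ∀ i j k, le i j → le j k → le i k)
    (sub : ∀ i j, le i j → Q i ⊆ Q j)
    (lam : ∀ i j, le i j ∨ le j i ∨ Disjoint (Q i) (Q j))
    (a sz : ι → ℝ≥0∞) (hσ : ∀ i, σ (Q i) ≤ sz i) (B : ℝ≥0∞)
    [DecidableRel le]
    (hC : ∀ j ∈ s, ∑ i ∈ s with le i j, a i ≤ B * sz j) (t : ℝ≥0∞)
    (ht : ∀ i ∈ s, t * sz i ≤ ∫⁻ x in Q i, g x ∂σ) :
    t * ∑ i ∈ s, a i ≤ B * ∫⁻ x in ⋃ i ∈ s, Q i, g x ∂σ ∧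
      t * σ (⋃ i ∈ s, Q i) ≤ ∫⁻ x in ⋃ i ∈ s, Q i, g x ∂σ := by
  classical
  obtain ⟨F, hF, hd, hc⟩ := exists_disjoint_cover s Q le refl trans lam
  have hU : ⋃ i ∈ s, Q i = ⋃ i ∈ F, Q i := by
    apply Set.Subset.antisymm
    · refine Set.iUnion₂_subset fun i hi => ?_
      obtain ⟨j, hj, hij⟩ := hc i hi
      exact (sub i j hij).trans (Set.subset_biUnion_of_mem (u := Q) hj)
    · exact Set.biUnion_subset_biUnion_left hF
  have hI : ∫⁻ x in ⋃ i ∈ s, Q i, g x ∂σ = ∑ i ∈ F, ∫⁻ x in Q i, g x ∂σ := by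
    rw [hU, lintegral_biUnion_finset hd fun i _ => hQ i]
  have hS : t * ∑ i ∈ F, sz i ≤ ∑ i ∈ F, ∫⁻ x in Q i, g x ∂σ := by
    rw [Finset.mul_sum]
    exact Finset.sum_le_sum fun i hi => ht i (hF hi)
  rw [hI]
  constructor
  · have : ∑ i ∈ s, a i ≤ ∑ j ∈ F, ∑ i ∈ s with le i j, a i := by
      simp_rw [Finset.sum_filter]
      rw [Finset.sum_comm]
      refine Finset.sum_le_sum fun i hi => ?_
      obtain ⟨j, hj, hij⟩ := hc i hi
      refine le_trans ?_ (Finset.single_le_sum (f := fun j => if le i j then a i else 0)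
        (fun _ _ => zero_le) hj)
      simp [hij]
    calc t * ∑ i ∈ s, a i ≤ t * ∑ j ∈ F, B * sz j := by
          gcongr
          exact this.trans (Finset.sum_le_sum fun j hj => hC j (hF hj))
      _ = B * (t * ∑ j ∈ F, sz j) := by rw [← Finset.mul_sum]; ring
      _ ≤ _ := by gcongr
  · rw [hU, measure_biUnion_finset hd fun i _ => hQ i]
    refine le_trans ?_ hS
    gcongr with i _
    exact hσ i

lemma setLIntegral_ne_top_of_sq {X : Type*} [MeasurableSpace X] {σ : Measure X} {g : X → ℝ≥0∞}
    (hg2 : ∫⁻ x, g x ^ 2 ∂σ ≠ ∞) {Q : Set X} (hQ : σ Q ≠ ∞) : ∫⁻ x in Q, g x ∂σ ≠ ∞ := by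
  have : ∫⁻ x in Q, g x ∂σ ≤ ∫⁻ x in Q, (1 + g x ^ 2) ∂σ := by
    refine lintegral_mono fun x => ?_
    rcases le_total (g x) 1 with h | h
    · exact h.trans le_self_add
    · exact (le_self_pow h two_ne_zero).trans le_add_self
  refine ne_top_of_le_ne_top ?_ this
  rw [lintegral_add_left measurable_const]
  simpa using ⟨hQ, ne_top_of_le_ne_top hg2 (setLIntegral_le_lintegral _ _)⟩

/-- **Carleson embedding with enlarged sizes.** The averages of `g` over `Q i` are normalised by
`sz i ≥ σ (Q i)` rather than by `σ (Q i)`, and the Carleson condition only has to hold with the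
sizes `sz` on the right-hand side. -/
theorem carleson_embedding {X ι : Type*} [MeasurableSpace X] (σ : Measure X) (g : X → ℝ≥0∞)
    (hg : Measurable g) (hg2 : ∫⁻ x, g x ^ 2 ∂σ ≠ ∞)
    (s : Finset ι) (Q : ι → Set X) (hQ : ∀ i, MeasurableSet (Q i)) (le : ι → ι → Prop)
    (refl : ∀ i, le i i) (trans : ∀ i j k, le i j → le j k → le i k)
    (sub : ∀ i j, le i j → Q i ⊆ Q j)
    (lam : ∀ i j, le i j ∨ le j i ∨ Disjoint (Q i) (Q j))
    (a sz : ι → ℝ≥0∞) (hsz : ∀ i, sz i ≠ ∞) (hσ : ∀ i, σ (Q i) ≤ sz i) (B : ℝ≥0∞)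
    [DecidableRel le]
    (hC : ∀ j ∈ s, ∑ i ∈ s with le i j, a i ≤ B * sz j) :
    ∑ i ∈ s, a i * ((∫⁻ x in Q i, g x ∂σ) / sz i) ^ 2 ≤ 4 * B * ∫⁻ x, g x ^ 2 ∂σ := by
  classical
  set A : ι → ℝ≥0∞ := fun i => (∫⁻ x in Q i, g x ∂σ) / sz i with hAdef
  set Φ : X → ℝ≥0∞ := fun x => s.sup fun i => (Q i).indicator (fun _ => A i) x with hΦdef
  have hσ' : ∀ i, σ (Q i) ≠ ∞ := fun i => ne_top_of_le_ne_top (hsz i) (hσ i)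
  have hA : ∀ i, A i ≠ ∞ := by
    intro i
    rcases eq_or_ne (sz i) 0 with h | h
    · have : σ (Q i) = 0 := le_antisymm ((hσ i).trans h.le) zero_le
      simp [hAdef, Measure.restrict_eq_zero.2 this]
    · exact ENNReal.div_ne_top (setLIntegral_ne_top_of_sq hg2 (hσ' i)) h
  have hΦm : Measurable Φ := by
    simp only [hΦdef, Finset.sup_eq_iSup]
    exact Measurable.biSup (s : Set ι) s.countable_toSet
      fun i _ => measurable_const.indicator (hQ i)
  have hΦle : ∀ x, Φ x ≤ ∑ i ∈ s, (Q i).indicator (fun _ => A i) x := fun x =>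
    Finset.sup_le fun i hi => Finset.single_le_sum
      (f := fun i => (Q i).indicator (fun _ => A i) x) (fun _ _ => zero_le) hi
  have hΦt : ∀ x, Φ x ≠ ∞ := fun x => by
    refine ne_top_of_le_ne_top (ENNReal.sum_ne_top.2 fun i _ => ?_) (hΦle x)
    by_cases hx : x ∈ Q i <;> simp [hx, hA]
  have hlev : ∀ t : ℝ≥0∞, {x | t < Φ x} = ⋃ i ∈ s.filter (fun i => t < A i), Q i := by
    intro t
    ext x
    simp only [Set.mem_ofPred_eq, hΦdef, Finset.lt_sup_iff, Set.mem_iUnion, Finset.mem_filter,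
      exists_prop]
    refine exists_congr fun i => ?_
    by_cases hx : x ∈ Q i <;> simp [hx]
  have weak := fun t : ℝ≥0∞ => weak_type_of_nested σ g (s.filter fun i => t < A i) Q hQ le refl
    trans sub lam a sz hσ B
    (fun j hj => (Finset.sum_le_sum_of_subset
      (Finset.filter_subset_filter _ (Finset.filter_subset _ _))).trans
        (hC j (Finset.mem_filter.1 hj).1)) t
    (fun i hi => ENNReal.mul_le_of_le_div (Finset.mem_filter.1 hi).2.le)
  have hUm : ∀ t : ℝ≥0∞, MeasurableSet (⋃ i ∈ s.filter (fun i => t < A i), Q i) :=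
    fun t => Finset.measurableSet_biUnion _ fun i _ => hQ i
  have hmul : ∫⁻ x, Φ x ∂σ.withDensity g = ∫⁻ x, g x * Φ x ∂σ :=
    lintegral_withDensity_eq_lintegral_mul σ hg hΦm
  -- the bound for the auxiliary maximal function `Φ`
  have h2 : ∫⁻ x, Φ x ^ 2 ∂σ ≤ 2 * ∫⁻ x, g x * Φ x ∂σ := by
    rw [← hmul]
    refine lintegral_sq_le_of_weak σ _ hΦm hΦm hΦt hΦt fun t _ => ?_
    rw [hlev t, withDensity_apply _ (hUm t)]
    exact (weak t).2
  -- Young's inequality; the finiteness of `∫ Φ²` then allows it to be absorbed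
  have hamgm : ∫⁻ x, g x * Φ x ∂σ ≤ ∫⁻ x, g x ^ 2 ∂σ + 4⁻¹ * ∫⁻ x, Φ x ^ 2 ∂σ := by
    rw [← lintegral_const_mul' _ _ (by simp), ← lintegral_add_left (hg.pow_const 2)]
    refine lintegral_mono fun x => ?_
    rcases eq_or_ne (g x) ∞ with hx | hx
    · simp [hx]
    · lift g x to ℝ≥0 using hx with u
      lift Φ x to ℝ≥0 using hΦt x with v
      rw [show (4⁻¹ : ℝ≥0∞) = ((4⁻¹ : ℝ≥0) : ℝ≥0∞) by simp]
      norm_cast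
      rw [← NNReal.coe_le_coe]
      push_cast
      nlinarith [sq_nonneg ((u : ℝ) - v / 2)]
  have hfin : ∫⁻ x, Φ x ^ 2 ∂σ ≠ ∞ := by
    have hb : ∀ x, Φ x ^ 2 ≤ ∑ i ∈ s, (Q i).indicator (fun _ => A i ^ 2) x := by
      intro x
      rcases s.eq_empty_or_nonempty with rfl | hs
      · simp [hΦdef]
      · obtain ⟨i, hi, hi'⟩ := Finset.exists_mem_eq_sup s hs
          fun i => (Q i).indicator (fun _ => A i) x
        simp only [hΦdef]
        rw [hi']
        refine le_trans ?_ (Finset.single_le_sum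
          (f := fun i => (Q i).indicator (fun _ => A i ^ 2) x) (fun _ _ => zero_le) hi)
        by_cases hx : x ∈ Q i <;> simp [hx]
    refine ne_top_of_le_ne_top ?_ (lintegral_mono hb)
    rw [lintegral_finsetSum _ fun i _ => measurable_const.indicator (hQ i)]
    refine ENNReal.sum_ne_top.2 fun i _ => ?_
    rw [lintegral_indicator_const (hQ i)]
    exact ENNReal.mul_ne_top (ENNReal.pow_ne_top (hA i)) (hσ' i)
  have hgΦ : ∫⁻ x, g x * Φ x ∂σ ≤ 2 * ∫⁻ x, g x ^ 2 ∂σ := by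
    have hfin' : ∫⁻ x, g x * Φ x ∂σ ≠ ∞ := ne_top_of_le_ne_top
      (ENNReal.add_ne_top.2 ⟨hg2, ENNReal.mul_ne_top (by simp) hfin⟩) hamgm
    have h4 : (4⁻¹ : ℝ≥0∞) = ((4⁻¹ : ℝ≥0) : ℝ≥0∞) := by simp
    rw [h4] at hamgm
    generalize ∫⁻ x, g x * Φ x ∂σ = I at *
    generalize ∫⁻ x, g x ^ 2 ∂σ = G at *
    generalize ∫⁻ x, Φ x ^ 2 ∂σ = P at *
    lift I to ℝ≥0 using hfin'
    lift G to ℝ≥0 using hg2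
    lift P to ℝ≥0 using hfin
    norm_cast at *
    rw [← NNReal.coe_le_coe] at *
    push_cast at *
    linarith
  -- the sum is an integral with respect to a discrete measure on the index set
  let _ : MeasurableSpace ι := ⊤
  have h1 : ∑ i ∈ s, a i * A i ^ 2 ≤ 2 * (B * ∫⁻ x, g x * Φ x ∂σ) := by
    have hAm : Measurable A := measurable_from_top
    have e : ∫⁻ i, A i ^ 2 ∂(∑ i ∈ s, a i • Measure.dirac i) = ∑ i ∈ s, a i * A i ^ 2 := by
      rw [lintegral_finsetSum_measure]
      exact Finset.sum_congr rfl fun i _ => by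
        rw [lintegral_smul_measure, lintegral_dirac' _ (hAm.pow_const 2), smul_eq_mul]
    rw [← e, ← hmul, ← smul_eq_mul B, ← lintegral_smul_measure]
    refine lintegral_sq_le_of_weak _ _ hAm hΦm hA hΦt fun t _ => ?_
    rw [hlev t, Measure.smul_apply, withDensity_apply _ (hUm t), smul_eq_mul]
    refine le_trans (le_of_eq ?_) (weak t).1
    rw [Measure.finsetSum_apply, Finset.sum_filter]
    congr 1
    refine Finset.sum_congr rfl fun i _ => ?_
    rw [Measure.smul_apply, Measure.dirac_apply' _ (MeasurableSpace.measurableSet_top), smul_eq_mul]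
    by_cases hi : t < A i <;> simp [hi]
  calc _ ≤ 2 * (B * ∫⁻ x, g x * Φ x ∂σ) := h1
    _ ≤ 2 * (B * (2 * ∫⁻ x, g x ^ 2 ∂σ)) := by gcongr
    _ = _ := by ring

/-- Linearisation of a finite maximal function: the sets `Q i` can be shrunk to disjoint sets
`E i` on which the `i`-th weight is the largest one. -/
lemma exists_disjoint_linearization {X ι : Type*} [MeasurableSpace X] (s : Finset ι)
    (Q : ι → Set X) (hQ : ∀ i, MeasurableSet (Q i)) (w : ι → ℝ≥0∞) :
    ∃ E : ι → Set X, (∀ i, MeasurableSet (E i)) ∧ (∀ i, E i ⊆ Q i) ∧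
      (s : Set ι).PairwiseDisjoint E ∧
      ∀ x, ∀ i ∈ s, x ∈ Q i → ∃ j ∈ s, x ∈ E j ∧ w i ≤ w j := by
  classical
  induction s using Finset.induction_on with
  | empty => exact ⟨fun _ => ∅, by simp⟩
  | insert a s ha ih =>
    obtain ⟨E, hE, hEQ, hd, hm⟩ := ih
    set E0 : Set X := Q a \ ⋃ i ∈ s.filter (fun i => w a ≤ w i), E i with hE0
    have hE0m : MeasurableSet E0 := (hQ a).diff (Finset.measurableSet_biUnion _ fun i _ => hE i)
    have hne : ∀ {j}, j ∈ s → j ≠ a := fun hj h => ha (h ▸ hj)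
    refine ⟨fun i => if i = a then E0 else E i \ E0, fun i => ?_, fun i => ?_, ?_, ?_⟩
    · dsimp only
      split_ifs
      exacts [hE0m, (hE i).diff hE0m]
    · dsimp only
      split_ifs with h
      exacts [h ▸ Set.sdiff_subset, Set.sdiff_subset.trans (hEQ i)]
    · intro i hi j hj hij
      simp only [Finset.coe_insert, Set.mem_insert_iff, Finset.mem_coe] at hi hj
      simp only [Function.onFun]
      split_ifs with h1 h2 h2
      · exact absurd (h1.trans h2.symm) hij
      · exact Set.disjoint_sdiff_right
      · exact Set.disjoint_sdiff_left
      · exact (hd (hi.resolve_left h1) (hj.resolve_left h2) hij).mono Set.sdiff_subset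
          Set.sdiff_subset
    · intro x i hi hx
      by_cases hx0 : x ∈ E0
      · refine ⟨a, Finset.mem_insert_self _ _, by simpa using hx0, ?_⟩
        rcases Finset.mem_insert.1 hi with rfl | hi
        · exact le_rfl
        · obtain ⟨j, hj, hxj, hij⟩ := hm x i hi hx
          refine hij.trans (le_of_not_ge fun hle => hx0.2 ?_)
          exact Set.mem_biUnion (Finset.mem_coe.2 (Finset.mem_filter.2 ⟨hj, hle⟩)) hxj
      · rcases Finset.mem_insert.1 hi with rfl | hi
        · have : x ∈ ⋃ j ∈ s.filter (fun j => w i ≤ w j), E j := by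
            by_contra hc
            exact hx0 ⟨hx, hc⟩
          obtain ⟨j, hj, hxj⟩ := Set.mem_iUnion₂.1 this
          obtain ⟨hj, hw⟩ := Finset.mem_filter.1 hj
          exact ⟨j, Finset.mem_insert_of_mem hj, by simpa [hne hj] using ⟨hxj, hx0⟩, hw⟩
        · obtain ⟨j, hj, hxj, hij⟩ := hm x i hi hx
          exact ⟨j, Finset.mem_insert_of_mem hj, by simpa [hne hj] using ⟨hxj, hx0⟩, hij⟩

/-! ### Cubes -/

variable {n : ℕ}

lemma side_pos (k : ℤ) : 0 < side k := zpow_pos two_pos k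

lemma side_add_nat (k : ℤ) (m : ℕ) : side (k + m) = 2 ^ m * side k := by
  rw [side, side, zpow_add₀ two_ne_zero, zpow_natCast, mul_comm]

lemma side_mono {k l : ℤ} (h : k ≤ l) : side k ≤ side l := zpow_le_zpow_right₀ one_le_two h

lemma cube_eq_pi (c : Fin n → ℝ) (s : ℝ) :
    cube c s = Set.pi Set.univ fun i => Set.Ico (c i - s / 2) (c i + s / 2) := by
  ext x
  simp [cube]

lemma measurableSet_cube (c : Fin n → ℝ) (s : ℝ) : MeasurableSet (cube c s) := by
  rw [cube_eq_pi]
  exact MeasurableSet.univ_pi fun _ => measurableSet_Ico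

lemma volume_cube (c : Fin n → ℝ) (s : ℝ) : volume (cube c s) = ENNReal.ofReal s ^ n := by
  rw [cube_eq_pi, Real.volume_pi_Ico]
  simp

lemma volume_cube_ne_zero (c : Fin n → ℝ) {s : ℝ} (hs : 0 < s) : volume (cube c s) ≠ 0 := by
  rw [volume_cube]
  exact pow_ne_zero _ (ENNReal.ofReal_pos.2 hs).ne'

lemma volume_cube_ne_top (c : Fin n → ℝ) (s : ℝ) : volume (cube c s) ≠ ∞ := by
  rw [volume_cube]
  exact ENNReal.pow_ne_top ENNReal.ofReal_ne_top

lemma volume_cube_pow_mul (c c' : Fin n → ℝ) (m : ℕ) (s : ℝ) :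
    volume (cube c' (2 ^ m * s)) = 2 ^ (m * n) * volume (cube c s) := by
  rw [volume_cube, volume_cube, ENNReal.ofReal_mul (by positivity), mul_pow,
    ENNReal.ofReal_pow zero_le_two, ENNReal.ofReal_ofNat, pow_mul]

lemma volume_cube_mono (c c' : Fin n → ℝ) {s t : ℝ} (h : s ≤ t) :
    volume (cube c s) ≤ volume (cube c' t) := by
  rw [volume_cube, volume_cube]
  gcongr

lemma measure_cube_ne_top (μ : Measure (Fin n → ℝ)) [IsLocallyFiniteMeasure μ] (c : Fin n → ℝ)
    (s : ℝ) : μ (cube c s) ≠ ∞ := by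
  have h : cube c s ⊆ Set.Icc (fun i => c i - s / 2) (fun i => c i + s / 2) :=
    fun x hx => ⟨fun i => (hx i).1, fun i => (hx i).2.le⟩
  exact ((measure_mono h).trans_lt isCompact_Icc.measure_lt_top).ne

lemma frontier_cube_subset (c : Fin n → ℝ) (s : ℝ) :
    frontier (cube c s) ⊆ ⋃ i, ({x | x i = c i - s / 2} ∪ {x | x i = c i + s / 2}) := by
  intro x hx
  by_contra hc
  simp only [Set.mem_iUnion, Set.mem_union, Set.mem_ofPred_eq, not_exists, not_or] at hc
  have hIcc : cube c s ⊆ Set.Icc (fun i => c i - s / 2) (fun i => c i + s / 2) :=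
    fun y hy => ⟨fun i => (hy i).1, fun i => (hy i).2.le⟩
  have hcl := closure_minimal hIcc isClosed_Icc hx.1
  refine hx.2 (mem_interior.2 ⟨Set.pi Set.univ fun i => Set.Ioo (c i - s / 2) (c i + s / 2),
    fun y hy i => ⟨(hy i trivial).1.le, (hy i trivial).2⟩,
    isOpen_set_pi Set.finite_univ fun _ _ => isOpen_Ioo, fun i _ => ⟨?_, ?_⟩⟩)
  · exact lt_of_le_of_ne (hcl.1 i) fun h => (hc i).1 h.symm
  · exact lt_of_le_of_ne (hcl.2 i) (hc i).2

/-- The inclusion of `cube c s` in `cube c' s'`, expressed through centres and sides. In positive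
dimension this is equivalent to the inclusion of non-empty cubes; in dimension `0` it still records
that `s ≤ s'`. -/
def Nested (c : Fin n → ℝ) (s : ℝ) (c' : Fin n → ℝ) (s' : ℝ) : Prop :=
  s ≤ s' ∧ ∀ i, |c i - c' i| ≤ (s' - s) / 2

namespace Nested

variable {c c' c'' : Fin n → ℝ} {s s' s'' : ℝ}

lemma subset (h : Nested c s c' s') : cube c s ⊆ cube c' s' := by
  intro x hx i
  have h1 := abs_le.1 (h.2 i)
  have h2 := hx i
  constructor <;> linarith [h1.1, h1.2, h2.1, h2.2]

lemma trans (h : Nested c s c' s') (h' : Nested c' s' c'' s'') : Nested c s c'' s'' := by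
  refine ⟨h.1.trans h'.1, fun i => ?_⟩
  have := abs_sub_le (c i) (c' i) (c'' i)
  linarith [h.2 i, h'.2 i]

lemma dilate (h : Nested c s c' s') {Γ : ℝ} (hΓ : 1 ≤ Γ) : Nested c (Γ * s) c' (Γ * s') := by
  refine ⟨by gcongr; exact h.1, fun i => ?_⟩
  have : 0 ≤ (Γ - 1) * (s' - s) := mul_nonneg (by linarith) (by linarith [h.1])
  linarith [h.2 i]

lemma of_le (c : Fin n → ℝ) (h : s ≤ s') : Nested c s c s' :=
  ⟨h, fun i => by rw [sub_self, abs_zero]; linarith⟩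

end Nested

/-! ### Adjacent dyadic grids -/

/-- A sequence of corners `o k` defining nested grids of cubes of side `2 ^ k`: the corners of
consecutive scales differ by integer multiples of the smaller side. -/
def IsGrid (o : ℤ → Fin n → ℝ) : Prop :=
  ∀ k i, ∃ z : ℤ, o (k + 1) i - o k i = z * side k

/-- The centre of the grid cube of scale `j.1` with integer coordinates `j.2`. -/
noncomputable def gridCenter (o : ℤ → Fin n → ℝ) (j : ℤ × (Fin n → ℤ)) (i : Fin n) : ℝ :=
  o j.1 i + (j.2 i + 1 / 2) * side j.1

/-- The grid cube of scale `j.1` with integer coordinates `j.2`. -/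
abbrev gridCube (o : ℤ → Fin n → ℝ) (j : ℤ × (Fin n → ℤ)) : Set (Fin n → ℝ) :=
  cube (gridCenter o j) (side j.1)

lemma mem_gridCube {o : ℤ → Fin n → ℝ} {j : ℤ × (Fin n → ℤ)} {x : Fin n → ℝ} :
    x ∈ gridCube o j ↔ ∀ i, o j.1 i + j.2 i * side j.1 ≤ x i ∧
      x i < o j.1 i + (j.2 i + 1) * side j.1 := by
  refine forall_congr' fun i => ?_
  simp only [gridCenter]
  constructor <;> rintro ⟨h1, h2⟩ <;> constructor <;> linarith

/-- The grid cube of scale `k` containing `x`. -/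
noncomputable def gridIndex (o : ℤ → Fin n → ℝ) (k : ℤ) (x : Fin n → ℝ) : ℤ × (Fin n → ℤ) :=
  (k, fun i => ⌊(x i - o k i) / side k⌋)

lemma mem_gridIndex (o : ℤ → Fin n → ℝ) (k : ℤ) (x : Fin n → ℝ) :
    x ∈ gridCube o (gridIndex o k x) := by
  rw [mem_gridCube]
  intro i
  have h1 := Int.floor_le ((x i - o k i) / side k)
  have h2 := Int.lt_floor_add_one ((x i - o k i) / side k)
  rw [le_div_iff₀ (side_pos k)] at h1
  rw [div_lt_iff₀ (side_pos k)] at h2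
  simp only [gridIndex]
  constructor <;> linarith

lemma IsGrid.exists_sub_eq {o : ℤ → Fin n → ℝ} (ho : IsGrid o) (k : ℤ) (m : ℕ) (i : Fin n) :
    ∃ z : ℤ, o (k + m) i - o k i = z * side k := by
  induction m with
  | zero => exact ⟨0, by simp⟩
  | succ m ih =>
    obtain ⟨z, hz⟩ := ih
    obtain ⟨w, hw⟩ := ho (k + m) i
    refine ⟨w * 2 ^ m + z, ?_⟩
    rw [side_add_nat] at hw
    push_cast
    rw [← add_assoc]
    linear_combination hz + hw

lemma IsGrid.nested {o : ℤ → Fin n → ℝ} (ho : IsGrid o) {j l : ℤ × (Fin n → ℤ)} (h : j.1 ≤ l.1)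
    {x : Fin n → ℝ} (hj : x ∈ gridCube o j) (hl : x ∈ gridCube o l) :
    Nested (gridCenter o j) (side j.1) (gridCenter o l) (side l.1) := by
  refine ⟨side_mono h, fun i => ?_⟩
  obtain ⟨m, hm⟩ := Int.le.dest h
  obtain ⟨z, hz⟩ := ho.exists_sub_eq j.1 m i
  have hs := side_add_nat j.1 m
  rw [hm] at hz hs
  have h1 := mem_gridCube.1 hj i
  have h2 := mem_gridCube.1 hl i
  have hp := side_pos j.1
  have ho' : o l.1 i = o j.1 i + z * side j.1 := by linarith
  rw [hs, ho'] at h2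
  have a1 : (z + 2 ^ m * l.2 i : ℤ) < j.2 i + 1 := by
    have : ((z + 2 ^ m * l.2 i : ℤ) : ℝ) * side j.1 < ((j.2 i + 1 : ℤ) : ℝ) * side j.1 := by
      push_cast
      linarith [h1.2, h2.1]
    exact_mod_cast lt_of_mul_lt_mul_right this hp.le
  have a2 : (j.2 i : ℤ) < z + 2 ^ m * l.2 i + 2 ^ m := by
    have : ((j.2 i : ℤ) : ℝ) * side j.1 < ((z + 2 ^ m * l.2 i + 2 ^ m : ℤ) : ℝ) * side j.1 := by
      push_cast
      linarith [h1.1, h2.2]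
    exact_mod_cast lt_of_mul_lt_mul_right this hp.le
  have b1 : ((z + 2 ^ m * l.2 i : ℤ) : ℝ) * side j.1 ≤ (j.2 i : ℤ) * side j.1 :=
    mul_le_mul_of_nonneg_right (by exact_mod_cast Int.lt_add_one_iff.1 a1) hp.le
  have b2 : ((j.2 i + 1 : ℤ) : ℝ) * side j.1 ≤ (z + 2 ^ m * l.2 i + 2 ^ m : ℤ) * side j.1 :=
    mul_le_mul_of_nonneg_right (by exact_mod_cast Int.add_one_le_iff.2 a2) hp.le
  push_cast at b1 b2
  simp only [gridCenter]
  rw [hs, ho', abs_le]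
  constructor <;> linarith

/-- The inclusion order on the cubes of a grid. -/
def GridLE (o : ℤ → Fin n → ℝ) (j l : ℤ × (Fin n → ℤ)) : Prop :=
  Nested (gridCenter o j) (side j.1) (gridCenter o l) (side l.1)

lemma IsGrid.le_or_le_or_disjoint {o : ℤ → Fin n → ℝ} (ho : IsGrid o) (j l : ℤ × (Fin n → ℤ)) :
    GridLE o j l ∨ GridLE o l j ∨ Disjoint (gridCube o j) (gridCube o l) := by
  by_cases hd : Disjoint (gridCube o j) (gridCube o l)
  · exact Or.inr (Or.inr hd)
  · obtain ⟨x, hx, hx'⟩ := Set.not_disjoint_iff.1 hd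
    rcases le_total j.1 l.1 with h | h
    exacts [Or.inl (ho.nested h hx hx'), Or.inr (Or.inl (ho.nested h hx' hx))]

/-- A grid cube has at most `2 ^ (r * n)` descendants that are `r` scales smaller. -/
lemma IsGrid.exists_descendants {o : ℤ → Fin n → ℝ} (ho : IsGrid o) (F : ℤ × (Fin n → ℤ))
    (r : ℕ) : ∃ S : Finset (ℤ × (Fin n → ℤ)), S.card ≤ 2 ^ (r * n) ∧
      (∀ G ∈ S, G.1 = F.1 - r ∧ GridLE o G F) ∧
      ∀ j, j.1 ≤ F.1 - r → GridLE o j F → ∃ G ∈ S, GridLE o j G := by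
  classical
  have hk : F.1 - r + (r : ℕ) = F.1 := by ring
  choose z hz using fun i => ho.exists_sub_eq (F.1 - r) r i
  have hs := side_add_nat (F.1 - r) r
  rw [hk] at hz hs
  have hp := side_pos (F.1 - r)
  set T : Finset (Fin n → ℤ) := Fintype.piFinset fun i =>
    Finset.Ico (z i + 2 ^ r * F.2 i) (z i + 2 ^ r * F.2 i + 2 ^ r) with hT
  have hcard : T.card = 2 ^ (r * n) := by
    rw [hT, Fintype.card_piFinset]
    have : ((2 : ℤ) ^ r).toNat = 2 ^ r := by
      rw [show (2 : ℤ) ^ r = ((2 ^ r : ℕ) : ℤ) by push_cast; rfl, Int.toNat_natCast]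
    simp [this, pow_mul]
  refine ⟨T.image fun m => (F.1 - r, m), Finset.card_image_le.trans hcard.le, ?_, ?_⟩
  · intro G hG
    obtain ⟨m, hm, rfl⟩ := Finset.mem_image.1 hG
    refine ⟨rfl, side_mono (by simp), fun i => ?_⟩
    have hmi := Finset.mem_Ico.1 (Fintype.mem_piFinset.1 hm i)
    have b1 : ((z i + 2 ^ r * F.2 i : ℤ) : ℝ) * side (F.1 - r) ≤ (m i : ℤ) * side (F.1 - r) :=
      mul_le_mul_of_nonneg_right (by exact_mod_cast hmi.1) hp.le
    have b2 : ((m i + 1 : ℤ) : ℝ) * side (F.1 - r) ≤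
        (z i + 2 ^ r * F.2 i + 2 ^ r : ℤ) * side (F.1 - r) :=
      mul_le_mul_of_nonneg_right (by exact_mod_cast Int.add_one_le_iff.2 hmi.2) hp.le
    push_cast at b1 b2
    have ho' : o F.1 i = o (F.1 - r) i + z i * side (F.1 - r) := by linarith [hz i]
    simp only [gridCenter]
    rw [hs, ho', abs_le]
    constructor <;> linarith
  · intro j hj hjF
    have hx : gridCenter o j ∈ gridCube o j := fun i => by
      have := side_pos j.1
      constructor <;> linarith
    have hxG := mem_gridIndex o (F.1 - r) (gridCenter o j)
    refine ⟨gridIndex o (F.1 - r) (gridCenter o j), ?_, ho.nested hj hx hxG⟩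
    refine Finset.mem_image.2 ⟨_, Fintype.mem_piFinset.2 fun i => ?_, rfl⟩
    have h1 := mem_gridCube.1 hxG i
    have h2 := mem_gridCube.1 (hjF.subset hx) i
    have ho' : o F.1 i = o (F.1 - r) i + z i * side (F.1 - r) := by linarith [hz i]
    rw [hs, ho'] at h2
    set q := ⌊(gridCenter o j i - o (F.1 - r) i) / side (F.1 - r)⌋ with hq
    simp only [gridIndex, ← hq] at h1
    have a1 : (z i + 2 ^ r * F.2 i : ℤ) < q + 1 := by
      have : ((z i + 2 ^ r * F.2 i : ℤ) : ℝ) * side (F.1 - r) <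
          ((q + 1 : ℤ) : ℝ) * side (F.1 - r) := by
        push_cast
        linarith [h1.2, h2.1]
      exact_mod_cast lt_of_mul_lt_mul_right this hp.le
    have a2 : q < z i + 2 ^ r * F.2 i + 2 ^ r := by
      have : (q : ℝ) * side (F.1 - r) <
          ((z i + 2 ^ r * F.2 i + 2 ^ r : ℤ) : ℝ) * side (F.1 - r) := by
        push_cast
        linarith [h1.1, h2.2]
      exact_mod_cast lt_of_mul_lt_mul_right this hp.le
    exact Finset.mem_Ico.2 ⟨Int.lt_add_one_iff.1 a1, a2⟩

/-- The corners of the adjacent dyadic grids: in the coordinates selected by `e` the grid of scale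
`k` is shifted by `± 2 ^ k / 3`, with alternating signs. The whole system is translated by `τ`. -/
noncomputable def shiftedGrid (τ : ℝ) (e : Fin n → Bool) (k : ℤ) (i : Fin n) : ℝ :=
  τ + if e i then (-2) ^ k / 3 else 0

lemma isGrid_shiftedGrid (τ : ℝ) (e : Fin n → Bool) : IsGrid (shiftedGrid τ e) := by
  intro k i
  simp only [shiftedGrid, side]
  by_cases h : e i
  · rcases Int.even_or_odd k with hk | hk
    · refine ⟨-1, ?_⟩
      simp only [h, if_true]
      rw [zpow_add_one₀ (by norm_num), hk.neg_zpow]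
      push_cast
      ring
    · refine ⟨1, ?_⟩
      simp only [h, if_true]
      rw [zpow_add_one₀ (by norm_num), hk.neg_zpow]
      push_cast
      ring
  · exact ⟨0, by simp [h]⟩

/-- The one-third trick: the grid points `L ℤ` and `L ℤ ± L / 3`, where `L = 2 ^ (k + 2)`, are too
far apart for an interval of length `2 ^ k` to contain points of both kinds. -/
lemma exists_gridCube_superset (τ : ℝ) (c : Fin n → ℝ) (k : ℤ) :
    ∃ (e : Fin n → Bool) (j : ℤ × (Fin n → ℤ)), j.1 = k + 2 ∧
      cube c (side k) ⊆ gridCube (shiftedGrid τ e) j := by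
  have hL : side (k + 2) = 4 * side k := by
    have := side_add_nat k 2
    norm_num at this
    exact this
  have hp := side_pos k
  have key : ∀ i, ∃ (b : Bool) (m : ℤ), ∀ o : ℝ,
      o = τ + (if b then (-2) ^ (k + 2) / 3 else 0) →
      o + m * (4 * side k) ≤ c i - side k / 2 ∧
        c i + side k / 2 ≤ o + (m + 1) * (4 * side k) := by
    intro i
    obtain ⟨ε, hε, hε'⟩ : ∃ ε : ℤ, (-2 : ℝ) ^ (k + 2) = ε * (4 * side k) ∧ (ε = 1 ∨ ε = -1) := by
      rw [← hL, side]
      rcases Int.even_or_odd (k + 2) with hk | hk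
      · exact ⟨1, by rw [hk.neg_zpow]; simp, Or.inl rfl⟩
      · exact ⟨-1, by rw [hk.neg_zpow]; simp, Or.inr rfl⟩
    set a := c i - side k / 2 with ha
    have hfl : ∀ o : ℝ, o + ⌊(a - o) / (4 * side k)⌋ * (4 * side k) ≤ a := fun o => by
      have h1 := Int.floor_le ((a - o) / (4 * side k))
      rw [le_div_iff₀ (by positivity)] at h1
      linarith
    have hfl' : ∀ o : ℝ, a < o + (⌊(a - o) / (4 * side k)⌋ + 1) * (4 * side k) := fun o => by
      have h1 := Int.lt_floor_add_one ((a - o) / (4 * side k))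
      rw [div_lt_iff₀ (by positivity)] at h1
      linarith
    by_contra hcon
    push Not at hcon
    obtain ⟨o, rfl, h0⟩ := hcon false ⌊(a - τ) / (4 * side k)⌋
    obtain ⟨o', rfl, h1⟩ := hcon true ⌊(a - (τ + ε * (4 * side k) / 3)) / (4 * side k)⌋
    simp only [if_true, Bool.false_eq_true, if_false, add_zero, hε] at h0 h1
    have h0 := h0 (hfl _)
    have h1 := h1 (hfl _)
    have g0 := hfl' τ
    have g1 := hfl' (τ + ε * (4 * side k) / 3)
    set p := ⌊(a - τ) / (4 * side k)⌋
    set q := ⌊(a - (τ + ε * (4 * side k) / 3)) / (4 * side k)⌋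
    have u1 : ((3 * (p - q) - ε : ℤ) : ℝ) * (4 * side k) < (1 : ℤ) * (4 * side k) := by
      push_cast
      linarith
    have u2 : ((-1 : ℤ) : ℝ) * (4 * side k) < (3 * (p - q) - ε : ℤ) * (4 * side k) := by
      push_cast
      linarith
    have v1 := lt_of_mul_lt_mul_right u1 (by positivity)
    have v2 := lt_of_mul_lt_mul_right u2 (by positivity)
    norm_cast at v1 v2
    omega
  choose e m hem using key
  refine ⟨e, (k + 2, m), rfl, fun x hx => mem_gridCube.2 fun i => ?_⟩
  have h := hem i (shiftedGrid τ e (k + 2) i) rfl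
  have hxi := hx i
  simp only [hL]
  exact ⟨h.1.trans hxi.1, hxi.2.trans_le h.2⟩

/-- A translation of the grids for which every cube concentric with a grid cube and with a dyadic
side length has a boundary of measure zero. -/
lemma exists_translation_frontier_null (ν : Measure (Fin n → ℝ)) [SFinite ν] :
    ∃ τ : ℝ, ∀ (e : Fin n → Bool) (j : ℤ × (Fin n → ℤ)) (k : ℤ),
      ν (frontier (cube (gridCenter (shiftedGrid τ e) j) (side k))) = 0 := by
  have hc : (⋃ (i : Fin n) (q : ℚ), (fun t : ℝ => t - q) ''
      {t : ℝ | 0 < ν {x : Fin n → ℝ | x i = t}}).Countable :=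
    Set.countable_iUnion fun i => Set.countable_iUnion fun q =>
      (Measure.countable_meas_level_set_pos (μ := ν) (g := fun x : Fin n → ℝ => x i)
        (measurable_pi_apply i)).image _
  obtain ⟨τ, hτ⟩ : ∃ τ, τ ∉ (⋃ (i : Fin n) (q : ℚ), (fun t : ℝ => t - q) ''
      {t : ℝ | 0 < ν {x : Fin n → ℝ | x i = t}}) := by
    by_contra h
    push Not at h
    exact Set.not_countable_univ (hc.mono fun x _ => h x)
  have hq : ∀ (i : Fin n) (q : ℚ) (t : ℝ), t = τ + q → ν {x : Fin n → ℝ | x i = t} = 0 := by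
    rintro i q _ rfl
    by_contra h
    exact hτ (Set.mem_iUnion₂.2 ⟨i, q, τ + q, pos_iff_ne_zero.2 h, by simp⟩)
  refine ⟨τ, fun e j k => measure_mono_null (frontier_cube_subset _ _) ?_⟩
  refine measure_iUnion_null fun i => measure_union_null ?_ ?_
  · refine hq i ((if e i then (-2) ^ j.1 / 3 else 0) + (j.2 i + 1 / 2) * 2 ^ j.1 - 2 ^ k / 2) _ ?_
    simp only [gridCenter, shiftedGrid, side]
    split_ifs <;> push_cast <;> ring
  · refine hq i ((if e i then (-2) ^ j.1 / 3 else 0) + (j.2 i + 1 / 2) * 2 ^ j.1 + 2 ^ k / 2) _ ?_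
    simp only [gridCenter, shiftedGrid, side]
    split_ifs <;> push_cast <;> ring

/-! ### Truncated maximal functions -/


/-- The maximal function over cubes of side at least `2 ^ K₀`. -/
noncomputable def maximalFrom (K₀ : ℤ) (μ : Measure (Fin n → ℝ)) (x : Fin n → ℝ) : ℝ≥0∞ :=
  ⨆ (c : Fin n → ℝ) (k : ℤ) (_ : K₀ ≤ k) (_ : x ∈ cube c (side k)),
    μ (cube c (side k)) / volume (cube c (side k))

/-- `K` bounds the square of the norm of `g ↦ ℳ(gσ)`, truncated to cubes of side at least
`2 ^ K₀`, from `L²(σ)` to `L²(ω)`. -/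
def TruncatedBound (σ ω : Measure (Fin n → ℝ)) (K₀ : ℤ) (K : ℝ≥0∞) : Prop :=
  ∀ g : (Fin n → ℝ) → ℝ≥0∞, Measurable g → ∫⁻ x, g x ^ 2 ∂σ ≠ ∞ →
    ∫⁻ x, maximalFrom K₀ (σ.withDensity g) x ^ 2 ∂ω ≤ K * ∫⁻ x, g x ^ 2 ∂σ

lemma le_maximal {μ : Measure (Fin n → ℝ)} {x c : Fin n → ℝ} {k : ℤ}
    (hx : x ∈ cube c (side k)) :
    μ (cube c (side k)) / volume (cube c (side k)) ≤ maximal μ x :=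
  le_iSup_of_le c <| le_iSup_of_le k <| le_iSup_of_le hx le_rfl

lemma le_maximalFrom {K₀ : ℤ} {μ : Measure (Fin n → ℝ)} {x c : Fin n → ℝ} {k : ℤ} (hk : K₀ ≤ k)
    (hx : x ∈ cube c (side k)) :
    μ (cube c (side k)) / volume (cube c (side k)) ≤ maximalFrom K₀ μ x :=
  le_iSup_of_le c <| le_iSup_of_le k <| le_iSup_of_le hk <| le_iSup_of_le hx le_rfl

lemma maximalFrom_le_maximal (K₀ : ℤ) (μ : Measure (Fin n → ℝ)) (x : Fin n → ℝ) :
    maximalFrom K₀ μ x ≤ maximal μ x :=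
  iSup_le fun _ => iSup_le fun _ => iSup_le fun _ => iSup_le fun hx => le_maximal hx

lemma le_rpow_half_of_sq_le {a L : ℝ≥0∞} (h : a ^ 2 ≤ L) : a ≤ L ^ (1 / 2 : ℝ) := by
  calc a = (a ^ 2) ^ (1 / 2 : ℝ) := by
        rw [← ENNReal.rpow_natCast, ← ENNReal.rpow_mul]; simp
    _ ≤ _ := by gcongr

lemma four_pow_eq_sq (m : ℕ) : (4 : ℝ≥0∞) ^ m = (2 ^ m) ^ 2 := by
  rw [← pow_mul, mul_comm, pow_mul]
  norm_num

lemma rpow_half_sq (L : ℝ≥0∞) : (L ^ (1 / 2 : ℝ)) ^ 2 = L := by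
  rw [← ENNReal.rpow_natCast, ← ENNReal.rpow_mul]; simp

lemma maximalFrom_sq_le {K₀ : ℤ} {μ : Measure (Fin n → ℝ)} {x : Fin n → ℝ} {L : ℝ≥0∞}
    (h : ∀ c k, K₀ ≤ k → x ∈ cube c (side k) →
      (μ (cube c (side k)) / volume (cube c (side k))) ^ 2 ≤ L) :
    maximalFrom K₀ μ x ^ 2 ≤ L := by
  rw [← rpow_half_sq L]
  gcongr
  exact iSup_le fun c => iSup_le fun k => iSup_le fun hk => iSup_le fun hx =>
    le_rpow_half_of_sq_le (h c k hk hx)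

lemma maximal_sq_le {μ : Measure (Fin n → ℝ)} {x : Fin n → ℝ} {L : ℝ≥0∞}
    (h : ∀ c k, x ∈ cube c (side k) →
      (μ (cube c (side k)) / volume (cube c (side k))) ^ 2 ≤ L) :
    maximal μ x ^ 2 ≤ L := by
  rw [← rpow_half_sq L]
  gcongr
  exact iSup_le fun c => iSup_le fun k => iSup_le fun hx => le_rpow_half_of_sq_le (h c k hx)

lemma mul_div_sq_le_iff {X I Y v : ℝ≥0∞} (hv : v ≠ 0) (hv' : v ≠ ∞) :
    X * (I / v) ^ 2 ≤ Y ↔ X * I ^ 2 ≤ Y * v ^ 2 := by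
  rw [← ENNReal.mul_le_mul_iff_left (pow_ne_zero 2 hv) (ENNReal.pow_ne_top hv'), mul_assoc,
    ← mul_pow, ENNReal.div_mul_cancel hv hv']

/-- The `A₂` condition for a cube whose side is a power of two times a given dyadic side. -/
lemma measure_mul_measure_le_muckenhoupt (σ ω : Measure (Fin n → ℝ)) (c : Fin n → ℝ) (k : ℤ)
    (m : ℕ) : σ (cube c (2 ^ m * side k)) * ω (cube c (2 ^ m * side k)) ≤
      4 ^ (m * n) * muckenhoupt σ ω * volume (cube c (side k)) ^ 2 := by
  have h : (σ (cube c (side (k + m))) / volume (cube c (side (k + m)))) *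
      (ω (cube c (side (k + m))) / volume (cube c (side (k + m)))) ≤ muckenhoupt σ ω :=
    le_iSup_of_le c <| le_iSup_of_le (k + m) le_rfl
  have hv := volume_cube_ne_zero c (side_pos (k + m))
  have hv' := volume_cube_ne_top c (side (k + m))
  have hvm : volume (cube c (side (k + m))) = 2 ^ (m * n) * volume (cube c (side k)) := by
    rw [side_add_nat, volume_cube_pow_mul]
  rw [← side_add_nat]
  calc _ = (σ (cube c (side (k + m))) / volume (cube c (side (k + m))) *
          volume (cube c (side (k + m)))) *
        (ω (cube c (side (k + m))) / volume (cube c (side (k + m))) *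
          volume (cube c (side (k + m)))) := by
        rw [ENNReal.div_mul_cancel hv hv', ENNReal.div_mul_cancel hv hv']
    _ = (σ (cube c (side (k + m))) / volume (cube c (side (k + m)))) *
      (ω (cube c (side (k + m))) / volume (cube c (side (k + m)))) *
        volume (cube c (side (k + m))) ^ 2 := by ring
    _ ≤ muckenhoupt σ ω * volume (cube c (side (k + m))) ^ 2 := by gcongr
    _ = _ := by
      rw [hvm, mul_pow, four_pow_eq_sq]
      ring

lemma sq_setLIntegral_le {X : Type*} [MeasurableSpace X] (σ : Measure X) {g : X → ℝ≥0∞}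
    (hg : Measurable g) (Q : Set X) :
    (∫⁻ x in Q, g x ∂σ) ^ 2 ≤ σ Q * ∫⁻ x, g x ^ 2 ∂σ := by
  have h := ENNReal.lintegral_mul_le_Lp_mul_Lq (σ.restrict Q) Real.HolderConjugate.two_two
    (f := fun _ => 1) (g := g) aemeasurable_const hg.aemeasurable
  simp only [Pi.mul_apply, one_mul, lintegral_const, Measure.restrict_apply,
    MeasurableSet.univ, Set.univ_inter, ENNReal.rpow_ofNat, one_pow] at h
  calc _ ≤ (σ Q ^ (1 / 2 : ℝ) * (∫⁻ x in Q, g x ^ 2 ∂σ) ^ (1 / 2 : ℝ)) ^ 2 := by gcongr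
    _ = σ Q * ∫⁻ x in Q, g x ^ 2 ∂σ := by rw [mul_pow, rpow_half_sq, rpow_half_sq]
    _ ≤ _ := by
      gcongr
      exact Measure.restrict_le_self

/-- If `A₂` is finite, the truncated maximal operator is bounded for the restriction of `ω` to a
bounded set. Large cubes are controlled by `A₂`, the remaining ones by local finiteness. -/
lemma exists_truncatedBound (σ ω : Measure (Fin n → ℝ)) [IsLocallyFiniteMeasure σ]
    [IsLocallyFiniteMeasure ω] (hA : muckenhoupt σ ω ≠ ∞) (K₀ M : ℤ) :
    ∃ K, K ≠ ∞ ∧ TruncatedBound σ (ω.restrict (cube 0 (side M))) K₀ K := by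
  set B : Set (Fin n → ℝ) := cube 0 (side M) with hB
  set v₀ := volume (cube (0 : Fin n → ℝ) (side K₀)) with hv₀
  have hv₀0 : v₀ ≠ 0 := volume_cube_ne_zero _ (side_pos _)
  have hv₀t : v₀ ≠ ∞ := volume_cube_ne_top _ _
  have hωB : ω B ≠ ∞ := measure_cube_ne_top ω _ _
  set K := ω B * σ (cube 0 (side (M + 2))) / v₀ ^ 2 + 4 ^ (2 * n) * muckenhoupt σ ω with hK
  have hKt : K ≠ ∞ := ENNReal.add_ne_top.2 ⟨ENNReal.div_ne_top
    (ENNReal.mul_ne_top hωB (measure_cube_ne_top σ _ _)) (pow_ne_zero _ hv₀0),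
    ENNReal.mul_ne_top (ENNReal.pow_ne_top ENNReal.ofNat_ne_top) hA⟩
  refine ⟨K, hKt, fun g hg hg2 => ?_⟩
  set G := ∫⁻ x, g x ^ 2 ∂σ
  rcases eq_or_ne (ω B) 0 with h0 | h0
  · simp [Measure.restrict_eq_zero.2 h0]
  have key : ∀ x ∈ B, maximalFrom K₀ (σ.withDensity g) x ^ 2 ≤ K * G / ω B := by
    intro x hx
    refine maximalFrom_sq_le fun c k hk hxc => ?_
    rw [ENNReal.le_div_iff_mul_le (Or.inl h0) (Or.inl hωB), mul_comm,
      mul_div_sq_le_iff (volume_cube_ne_zero c (side_pos k)) (volume_cube_ne_top c _),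
      withDensity_apply _ (measurableSet_cube _ _)]
    have hσ : ω B * σ (cube c (side k)) ≤ K * volume (cube c (side k)) ^ 2 := by
      rcases le_total k M with hkM | hkM
      · have hsub : cube c (side k) ⊆ cube 0 (side (M + 2)) := by
          have h4 := side_add_nat M 2
          have hkM' := side_mono hkM
          have hpM := side_pos M
          push_cast at h4
          intro y hy i
          have h1 := hx i
          have h2 := hxc i
          have h3 := hy i
          simp only [Pi.zero_apply] at h1 ⊢
          rw [h4]
          constructor <;> linarith [h1.1, h1.2, h2.1, h2.2, h3.1, h3.2]
        have hv : v₀ ≤ volume (cube c (side k)) := volume_cube_mono _ _ (side_mono hk)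
        calc ω B * σ (cube c (side k)) ≤ ω B * σ (cube 0 (side (M + 2))) := by gcongr
          _ = ω B * σ (cube 0 (side (M + 2))) / v₀ ^ 2 * v₀ ^ 2 :=
            (ENNReal.div_mul_cancel (pow_ne_zero _ hv₀0) (ENNReal.pow_ne_top hv₀t)).symm
          _ ≤ K * volume (cube c (side k)) ^ 2 := by
            gcongr
            exact le_self_add
      · have hsub : B ⊆ cube c (2 ^ 2 * side k) := by
          have hkM' := side_mono hkM
          have hpM := side_pos M
          intro y hy i
          have h1 := hx i
          have h2 := hxc i
          have h3 := hy i
          simp only [Pi.zero_apply] at h1 h3 ⊢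
          constructor <;> linarith [h1.1, h1.2, h2.1, h2.2, h3.1, h3.2]
        have hsub' : cube c (side k) ⊆ cube c (2 ^ 2 * side k) :=
          (Nested.of_le c (by linarith [side_pos k])).subset
        calc ω B * σ (cube c (side k))
            ≤ ω (cube c (2 ^ 2 * side k)) * σ (cube c (2 ^ 2 * side k)) := by gcongr
          _ = σ (cube c (2 ^ 2 * side k)) * ω (cube c (2 ^ 2 * side k)) := mul_comm _ _
          _ ≤ 4 ^ (2 * n) * muckenhoupt σ ω * volume (cube c (side k)) ^ 2 :=
            measure_mul_measure_le_muckenhoupt σ ω c k 2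
          _ ≤ _ := by
            gcongr
            exact le_add_self
    calc ω B * (∫⁻ x in cube c (side k), g x ∂σ) ^ 2 ≤ ω B * (σ (cube c (side k)) * G) := by
          gcongr
          exact sq_setLIntegral_le σ hg _
      _ = ω B * σ (cube c (side k)) * G := by ring
      _ ≤ K * volume (cube c (side k)) ^ 2 * G := by gcongr
      _ = _ := by ring
  calc _ ≤ ∫⁻ _ in B, K * G / ω B ∂ω := setLIntegral_mono' (measurableSet_cube _ _) key
    _ = K * G := by
      rw [setLIntegral_const, ENNReal.div_mul_cancel h0 hωB]

/-! ### The Carleson condition -/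

/-- Restricted testing and an a priori bound give a testing inequality for *every* cube, with the
measure of the dilated cube on the right-hand side: if the doubling condition fails, the a priori
bound gains the factor `1 / D`. -/
lemma lintegral_maximalFrom_restrict_le {σ ω ω' : Measure (Fin n → ℝ)} (hω : ω' ≤ ω)
    [IsLocallyFiniteMeasure σ] {K₀ : ℤ} {K T : ℝ≥0∞} {Γ D : ℝ} (hΓ : 1 ≤ Γ) (hD : 0 < D)
    (hK : TruncatedBound σ ω' K₀ K) (c : Fin n → ℝ) (k : ℤ)
    (hT : σ (cube c (Γ * side k)) ≤ ENNReal.ofReal D * σ (cube c (side k)) →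
      ∫⁻ x in cube c (side k), maximal (σ.restrict (cube c (side k))) x ^ 2 ∂ω
        ≤ T ^ 2 * σ (cube c (side k))) :
    ∫⁻ x in cube c (side k), maximalFrom K₀ (σ.restrict (cube c (side k))) x ^ 2 ∂ω' ≤
      (T ^ 2 + K / ENNReal.ofReal D) * σ (cube c (Γ * side k)) := by
  have hsub : cube c (side k) ⊆ cube c (Γ * side k) :=
    (Nested.of_le c (le_mul_of_one_le_left (side_pos k).le hΓ)).subset
  have hm := measurableSet_cube c (side k)
  by_cases hd : σ (cube c (Γ * side k)) ≤ ENNReal.ofReal D * σ (cube c (side k))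
  · calc _ ≤ ∫⁻ x in cube c (side k), maximal (σ.restrict (cube c (side k))) x ^ 2 ∂ω :=
          lintegral_mono' (Measure.restrict_mono le_rfl hω) fun x => by
            dsimp only
            gcongr
            exact maximalFrom_le_maximal _ _ _
      _ ≤ T ^ 2 * σ (cube c (side k)) := hT hd
      _ ≤ _ := by
        gcongr
        exact le_self_add
  · have hD0 : ENNReal.ofReal D ≠ 0 := (ENNReal.ofReal_pos.2 hD).ne'
    have h1 : ∫⁻ x, (cube c (side k)).indicator 1 x ^ 2 ∂σ = σ (cube c (side k)) := by
      rw [← lintegral_indicator_one hm]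
      refine lintegral_congr fun x => ?_
      by_cases hx : x ∈ cube c (side k) <;> simp [hx]
    have h := hK ((cube c (side k)).indicator 1) (measurable_one.indicator hm)
      (h1 ▸ measure_cube_ne_top σ _ _)
    rw [withDensity_indicator_one hm, h1] at h
    calc _ ≤ ∫⁻ x, maximalFrom K₀ (σ.restrict (cube c (side k))) x ^ 2 ∂ω' :=
          setLIntegral_le_lintegral _ _
      _ ≤ K * σ (cube c (side k)) := h
      _ ≤ K * (σ (cube c (Γ * side k)) / ENNReal.ofReal D) := by
        gcongr
        rw [ENNReal.le_div_iff_mul_le (Or.inl hD0) (Or.inl ENNReal.ofReal_ne_top), mul_comm]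
        exact (not_le.1 hd).le
      _ = K / ENNReal.ofReal D * σ (cube c (Γ * side k)) := by
        simp only [div_eq_mul_inv]; ring
      _ ≤ _ := by
        gcongr
        exact le_add_self

/-- The part of the Carleson sum inside a small grid cube `G` is controlled by the testing integral
over the concentric cube `P` with `2 ^ v` times the side, because `P` contains `ΓG`. -/
lemma sum_le_lintegral_maximalFrom {σ ω' : Measure (Fin n → ℝ)} {K₀ : ℤ} {Γ : ℝ} (hΓ : 1 ≤ Γ)
    {v : ℕ} (hv : Γ ≤ 2 ^ v) {o : ℤ → Fin n → ℝ} (s : Finset (ℤ × (Fin n → ℤ)))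
    (E : ℤ × (Fin n → ℤ) → Set (Fin n → ℝ)) (hE : ∀ i, MeasurableSet (E i))
    (hEQ : ∀ i, E i ⊆ gridCube o i) (hd : (s : Set (ℤ × (Fin n → ℤ))).PairwiseDisjoint E)
    (hs : ∀ i ∈ s, K₀ ≤ i.1) (G : ℤ × (Fin n → ℤ)) (hG : ∀ i ∈ s, GridLE o i G) :
    ∑ i ∈ s, ω' (E i) *
        (σ (cube (gridCenter o i) (Γ * side i.1)) / volume (gridCube o i)) ^ 2 ≤
      4 ^ (v * n) * ∫⁻ x in cube (gridCenter o G) (side (G.1 + v)),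
        maximalFrom K₀ (σ.restrict (cube (gridCenter o G) (side (G.1 + v)))) x ^ 2 ∂ω' := by
  set P := cube (gridCenter o G) (side (G.1 + v)) with hP
  have hΓv : ∀ k : ℤ, Γ * side k ≤ side (k + v) := fun k => by
    rw [side_add_nat]
    exact mul_le_mul_of_nonneg_right hv (side_pos k).le
  have hsP : ∀ i ∈ s, cube (gridCenter o i) (Γ * side i.1) ⊆ P := fun i hi =>
    ((Nested.dilate (hG i hi) hΓ).trans (Nested.of_le _ (hΓv G.1))).subset
  have hQΓ : ∀ i, gridCube o i ⊆ cube (gridCenter o i) (Γ * side i.1) := fun i =>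
    (Nested.of_le _ (le_mul_of_one_le_left (side_pos _).le hΓ)).subset
  have hpt : ∀ i ∈ s, ∀ x ∈ E i,
      (σ (cube (gridCenter o i) (Γ * side i.1)) / volume (gridCube o i)) ^ 2 ≤
        4 ^ (v * n) * maximalFrom K₀ (σ.restrict P) x ^ 2 := by
    intro i hi x hx
    have hx' : x ∈ cube (gridCenter o i) (side (i.1 + v)) :=
      (Nested.of_le _ (hΓv i.1)).subset (hQΓ i (hEQ i hx))
    have h := le_maximalFrom (K₀ := K₀) (μ := σ.restrict P)
      ((hs i hi).trans (by simp)) hx'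
    have hvol : volume (cube (gridCenter o i) (side (i.1 + v))) =
        2 ^ (v * n) * volume (gridCube o i) := by
      rw [side_add_nat, volume_cube_pow_mul]
    rw [four_pow_eq_sq, ← mul_pow]
    gcongr
    have h2 : (2 : ℝ≥0∞) ^ (v * n) ≠ 0 := pow_ne_zero _ two_ne_zero
    have h2' : (2 : ℝ≥0∞) ^ (v * n) ≠ ∞ := ENNReal.pow_ne_top ENNReal.ofNat_ne_top
    calc σ (cube (gridCenter o i) (Γ * side i.1)) / volume (gridCube o i)
        = 2 ^ (v * n) * σ (cube (gridCenter o i) (Γ * side i.1)) /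
            (2 ^ (v * n) * volume (gridCube o i)) :=
          (ENNReal.mul_div_mul_left _ _ h2 h2').symm
      _ ≤ 2 ^ (v * n) * (σ.restrict P (cube (gridCenter o i) (side (i.1 + v))) /
            volume (cube (gridCenter o i) (side (i.1 + v)))) := by
          rw [hvol, mul_div_assoc]
          refine mul_le_mul_right (ENNReal.div_le_div_right ?_ _) _
          rw [Measure.restrict_apply (measurableSet_cube _ _)]
          exact measure_mono (Set.subset_inter (Nested.of_le _ (hΓv i.1)).subset (hsP i hi))
      _ ≤ _ := by gcongr
  calc _ ≤ ∑ i ∈ s, ∫⁻ x in E i, 4 ^ (v * n) * maximalFrom K₀ (σ.restrict P) x ^ 2 ∂ω' := by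
        refine Finset.sum_le_sum fun i hi => ?_
        rw [mul_comm, ← setLIntegral_const]
        exact setLIntegral_mono' (hE i) (hpt i hi)
    _ = ∫⁻ x in ⋃ i ∈ s, E i, 4 ^ (v * n) * maximalFrom K₀ (σ.restrict P) x ^ 2 ∂ω' :=
        (lintegral_biUnion_finset hd (fun i _ => hE i) _).symm
    _ ≤ ∫⁻ x in P, 4 ^ (v * n) * maximalFrom K₀ (σ.restrict P) x ^ 2 ∂ω' :=
        lintegral_mono_set (Set.iUnion₂_subset fun i hi =>
          (hEQ i).trans ((hQΓ i).trans (hsP i hi)))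
    _ = _ := lintegral_const_mul' _ _ (ENNReal.pow_ne_top ENNReal.ofNat_ne_top)

/-- The part of the Carleson sum coming from the cubes of side comparable to that of `F` is
controlled by the `A₂` condition. -/
lemma sum_le_muckenhoupt {σ ω ω' : Measure (Fin n → ℝ)} (hω : ω' ≤ ω) {Γ : ℝ} (hΓ : 1 ≤ Γ)
    {v : ℕ} (hv : Γ ≤ 2 ^ v) (r : ℕ) {o : ℤ → Fin n → ℝ} (s : Finset (ℤ × (Fin n → ℤ)))
    (E : ℤ × (Fin n → ℤ) → Set (Fin n → ℝ)) (hE : ∀ i, MeasurableSet (E i))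
    (hEQ : ∀ i, E i ⊆ gridCube o i) (hd : (s : Set (ℤ × (Fin n → ℤ))).PairwiseDisjoint E)
    (F : ℤ × (Fin n → ℤ)) (hF : ∀ i ∈ s, GridLE o i F) (hs : ∀ i ∈ s, F.1 - r ≤ i.1) :
    ∑ i ∈ s, ω' (E i) *
        (σ (cube (gridCenter o i) (Γ * side i.1)) / volume (gridCube o i)) ^ 2 ≤
      4 ^ (r * n) * 4 ^ (v * n) * muckenhoupt σ ω *
        σ (cube (gridCenter o F) (Γ * side F.1)) := by
  set S := σ (cube (gridCenter o F) (Γ * side F.1)) with hS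
  set V := volume (gridCube o F) with hV
  have hV0 : V ≠ 0 := volume_cube_ne_zero _ (side_pos _)
  have hVt : V ≠ ∞ := volume_cube_ne_top _ _
  have hΓF : cube (gridCenter o F) (Γ * side F.1) ⊆ cube (gridCenter o F) (2 ^ v * side F.1) :=
    (Nested.of_le _ (mul_le_mul_of_nonneg_right hv (side_pos _).le)).subset
  have hFΓ : gridCube o F ⊆ cube (gridCenter o F) (2 ^ v * side F.1) :=
    (Nested.of_le _ (le_mul_of_one_le_left (side_pos _).le (hΓ.trans hv))).subset
  have hterm : ∀ i ∈ s, σ (cube (gridCenter o i) (Γ * side i.1)) / volume (gridCube o i) ≤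
      2 ^ (r * n) * S / V := by
    intro i hi
    refine ENNReal.div_le_of_le_mul ?_
    have hvol : V ≤ 2 ^ (r * n) * volume (gridCube o i) := by
      rw [← volume_cube_pow_mul (gridCenter o i) (gridCenter o F), ← side_add_nat]
      exact volume_cube_mono _ _ (side_mono (by linarith [hs i hi]))
    calc σ (cube (gridCenter o i) (Γ * side i.1)) ≤ S :=
          measure_mono (Nested.dilate (hF i hi) hΓ).subset
      _ = S / V * V := (ENNReal.div_mul_cancel hV0 hVt).symm
      _ ≤ S / V * (2 ^ (r * n) * volume (gridCube o i)) := by gcongr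
      _ = _ := by simp only [div_eq_mul_inv]; ring
  calc _ ≤ ∑ i ∈ s, ω' (E i) * (2 ^ (r * n) * S / V) ^ 2 := by
        refine Finset.sum_le_sum fun i hi => ?_
        exact mul_le_mul_right (pow_le_pow_left' (hterm i hi) 2) _
    _ = ω' (⋃ i ∈ s, E i) * (2 ^ (r * n) * S / V) ^ 2 := by
        rw [measure_biUnion_finset hd fun i _ => hE i, Finset.sum_mul]
    _ ≤ ω (cube (gridCenter o F) (2 ^ v * side F.1)) * (2 ^ (r * n) * S / V) ^ 2 := by
        refine mul_le_mul_left ((hω _).trans (measure_mono (Set.iUnion₂_subset fun i hi => ?_))) _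
        exact (hEQ i).trans ((hF i hi).subset.trans hFΓ)
    _ ≤ _ := by
        rw [mul_div_sq_le_iff hV0 hVt]
        calc ω (cube (gridCenter o F) (2 ^ v * side F.1)) * (2 ^ (r * n) * S) ^ 2
            = 4 ^ (r * n) * S * (S * ω (cube (gridCenter o F) (2 ^ v * side F.1))) := by
              rw [four_pow_eq_sq]; ring
          _ ≤ 4 ^ (r * n) * S * (σ (cube (gridCenter o F) (2 ^ v * side F.1)) *
                ω (cube (gridCenter o F) (2 ^ v * side F.1))) :=
              mul_le_mul_right (mul_le_mul_left (measure_mono hΓF) _) _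
          _ ≤ 4 ^ (r * n) * S * (4 ^ (v * n) * muckenhoupt σ ω * V ^ 2) :=
              mul_le_mul_right (measure_mul_measure_le_muckenhoupt σ ω _ _ v) _
          _ = _ := by ring

/-- The Carleson condition, with the measure of the dilated cube `ΓF` on the right-hand side.
Cubes that are much smaller than `F` lie in one of boundedly many descendants `G` of `F`, so small
that the testing cubes concentric with them have their `Γ`-dilates inside `ΓF`. -/
lemma carleson_condition {σ ω ω' : Measure (Fin n → ℝ)} [IsLocallyFiniteMeasure σ] (hω : ω' ≤ ω)
    {K₀ : ℤ} {K T : ℝ≥0∞} {Γ D : ℝ} (hΓ : 1 < Γ) (hD : 0 < D)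
    {u v : ℕ} (hu : Γ ≤ 2 ^ u * (Γ - 1)) (hv : Γ ≤ 2 ^ v) {o : ℤ → Fin n → ℝ} (ho : IsGrid o)
    (hK : TruncatedBound σ ω' K₀ K)
    (hT : ∀ (j : ℤ × (Fin n → ℤ)) (k : ℤ), σ (cube (gridCenter o j) (Γ * side k)) ≤
        ENNReal.ofReal D * σ (cube (gridCenter o j) (side k)) →
      ∫⁻ x in cube (gridCenter o j) (side k),
        maximal (σ.restrict (cube (gridCenter o j) (side k))) x ^ 2 ∂ω
        ≤ T ^ 2 * σ (cube (gridCenter o j) (side k)))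
    (s : Finset (ℤ × (Fin n → ℤ)))
    (E : ℤ × (Fin n → ℤ) → Set (Fin n → ℝ)) (hE : ∀ i, MeasurableSet (E i))
    (hEQ : ∀ i, E i ⊆ gridCube o i) (hd : (s : Set (ℤ × (Fin n → ℤ))).PairwiseDisjoint E)
    (hs : ∀ i ∈ s, K₀ ≤ i.1) (F : ℤ × (Fin n → ℤ)) (hF : ∀ i ∈ s, GridLE o i F) :
    ∑ i ∈ s, ω' (E i) *
        (σ (cube (gridCenter o i) (Γ * side i.1)) / volume (gridCube o i)) ^ 2 ≤
      4 ^ ((u + v) * n) * 4 ^ (v * n) * (T ^ 2 + muckenhoupt σ ω + K / ENNReal.ofReal D) *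
        σ (cube (gridCenter o F) (Γ * side F.1)) := by
  classical
  set a : ℤ × (Fin n → ℤ) → ℝ≥0∞ := fun i => ω' (E i) *
    (σ (cube (gridCenter o i) (Γ * side i.1)) / volume (gridCube o i)) ^ 2 with ha
  set S := σ (cube (gridCenter o F) (Γ * side F.1)) with hS
  obtain ⟨𝒢, hcard, hG, hcov⟩ := ho.exists_descendants F (u + v)
  set R := T ^ 2 + K / ENNReal.ofReal D with hR
  have hsG : ∀ G ∈ 𝒢, ∑ i ∈ s with GridLE o i G, a i ≤ 4 ^ (v * n) * (R * S) := by
    intro G hG'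
    obtain ⟨hG1, hGF⟩ := hG G hG'
    refine (sum_le_lintegral_maximalFrom hΓ.le hv (s.filter fun i => GridLE o i G) E hE hEQ
      (hd.subset (Finset.coe_subset.2 (Finset.filter_subset _ _)))
      (fun i hi => hs i (Finset.mem_filter.1 hi).1) G
      (fun i hi => (Finset.mem_filter.1 hi).2) (σ := σ)).trans ?_
    gcongr
    refine (lintegral_maximalFrom_restrict_le hω hΓ.le hD hK _ _ (hT G _)).trans
      (mul_le_mul_right (measure_mono ?_) _)
    have hside : side F.1 = 2 ^ u * side (G.1 + v) := by
      rw [← side_add_nat, hG1]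
      congr 1
      push_cast
      ring
    have hΓs : Γ * side (G.1 + v) ≤ (Γ - 1) * side F.1 := by
      rw [hside]
      calc Γ * side (G.1 + v) ≤ 2 ^ u * (Γ - 1) * side (G.1 + v) :=
            mul_le_mul_of_nonneg_right hu (side_pos _).le
        _ = _ := by ring
    have hp := side_pos F.1
    refine Nested.subset ⟨by linarith, fun i => ?_⟩
    have := hGF.2 i
    have := side_pos G.1
    linarith
  have hsplit : ∑ i ∈ s, a i = ∑ i ∈ s with i.1 ≤ F.1 - (u + v : ℕ), a i +
      ∑ i ∈ s with ¬ i.1 ≤ F.1 - (u + v : ℕ), a i :=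
    (Finset.sum_filter_add_sum_filter_not _ _ _).symm
  have hsmall : ∑ i ∈ s with i.1 ≤ F.1 - (u + v : ℕ), a i ≤
      2 ^ ((u + v) * n) * (4 ^ (v * n) * (R * S)) := by
    calc _ ≤ ∑ G ∈ 𝒢, ∑ i ∈ s with GridLE o i G, a i := by
          simp_rw [Finset.sum_filter]
          rw [Finset.sum_comm]
          refine Finset.sum_le_sum fun i hi => ?_
          split_ifs with hi'
          · obtain ⟨G, hG', hiG⟩ := hcov i hi' (hF i hi)
            refine le_trans ?_ (Finset.single_le_sum
              (f := fun G => if GridLE o i G then a i else 0) (fun _ _ => zero_le) hG')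
            simp [hiG]
          · exact zero_le
      _ ≤ ∑ G ∈ 𝒢, 4 ^ (v * n) * (R * S) := Finset.sum_le_sum hsG
      _ = 𝒢.card * (4 ^ (v * n) * (R * S)) := by rw [Finset.sum_const, nsmul_eq_mul]
      _ ≤ _ := by
        gcongr
        exact_mod_cast hcard
  have hlarge := sum_le_muckenhoupt (σ := σ) hω hΓ.le hv (u + v)
    (s.filter fun i => ¬ i.1 ≤ F.1 - (u + v : ℕ)) E hE hEQ
    (hd.subset (Finset.coe_subset.2 (Finset.filter_subset _ _))) F
    (fun i hi => hF i (Finset.mem_filter.1 hi).1)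
    (fun i hi => (not_le.1 (Finset.mem_filter.1 hi).2).le)
  rw [hsplit]
  calc _ ≤ 2 ^ ((u + v) * n) * (4 ^ (v * n) * (R * S)) +
        4 ^ ((u + v) * n) * 4 ^ (v * n) * muckenhoupt σ ω * S := add_le_add hsmall hlarge
    _ ≤ 4 ^ ((u + v) * n) * (4 ^ (v * n) * (R * S)) +
        4 ^ ((u + v) * n) * 4 ^ (v * n) * muckenhoupt σ ω * S := by
      gcongr
      norm_num
    _ = _ := by rw [hR]; ring

/-! ### Boundedness of the maximal operator -/


/-- A bound for the maximal functions of all finite subfamilies of a countable family of sets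
passes to the maximal function of the whole family. -/
lemma lintegral_iSup_indicator_sq_le {X ι : Type*} [MeasurableSpace X] [Countable ι]
    (μ : Measure X) (Q : ι → Set X) (hQ : ∀ i, MeasurableSet (Q i)) (w : ι → ℝ≥0∞) {L : ℝ≥0∞}
    (h : ∀ s : Finset ι, ∫⁻ x, (s.sup fun i => (Q i).indicator (fun _ => w i ^ 2) x) ∂μ ≤ L) :
    ∫⁻ x, (⨆ i, (Q i).indicator (fun _ => w i ^ 2) x) ∂μ ≤ L := by
  have e : ∀ x, (⨆ i, (Q i).indicator (fun _ => w i ^ 2) x) =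
      ⨆ s : Finset ι, s.sup fun i => (Q i).indicator (fun _ => w i ^ 2) x := fun x => by
    simp only [Finset.sup_eq_iSup]
    exact iSup_eq_iSup_finset _
  simp_rw [e]
  rw [lintegral_iSup_directed]
  · exact iSup_le h
  · intro s
    simp only [Finset.sup_eq_iSup]
    exact (Measurable.biSup (s : Set ι) s.countable_toSet
      fun i _ => measurable_const.indicator (hQ i)).aemeasurable
  · classical
    exact fun s t => ⟨s ∪ t, fun x => Finset.sup_mono Finset.subset_union_left,
      fun x => Finset.sup_mono Finset.subset_union_right⟩

/-- The maximal function of a finite family of grid cubes: it is linearised, and the resulting sum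
is estimated by the Carleson embedding. -/
lemma lintegral_gridMax_le {σ ω ω' : Measure (Fin n → ℝ)} [IsLocallyFiniteMeasure σ] (hω : ω' ≤ ω)
    {K₀ : ℤ} {K T : ℝ≥0∞} {Γ D : ℝ} (hΓ : 1 < Γ) (hD : 0 < D)
    {u v : ℕ} (hu : Γ ≤ 2 ^ u * (Γ - 1)) (hv : Γ ≤ 2 ^ v) {o : ℤ → Fin n → ℝ} (ho : IsGrid o)
    (hK : TruncatedBound σ ω' K₀ K)
    (hT : ∀ (j : ℤ × (Fin n → ℤ)) (k : ℤ), σ (cube (gridCenter o j) (Γ * side k)) ≤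
        ENNReal.ofReal D * σ (cube (gridCenter o j) (side k)) →
      ∫⁻ x in cube (gridCenter o j) (side k),
        maximal (σ.restrict (cube (gridCenter o j) (side k))) x ^ 2 ∂ω
        ≤ T ^ 2 * σ (cube (gridCenter o j) (side k)))
    (g : (Fin n → ℝ) → ℝ≥0∞) (hg : Measurable g) (hg2 : ∫⁻ x, g x ^ 2 ∂σ ≠ ∞)
    (s : Finset (ℤ × (Fin n → ℤ))) (hs : ∀ i ∈ s, K₀ ≤ i.1) :
    ∫⁻ x, (s.sup fun i => (gridCube o i).indicator
        (fun _ => (σ.withDensity g (gridCube o i) / volume (gridCube o i)) ^ 2) x) ∂ω' ≤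
      4 * (4 ^ ((u + v) * n) * 4 ^ (v * n) *
        (T ^ 2 + muckenhoupt σ ω + K / ENNReal.ofReal D)) * ∫⁻ x, g x ^ 2 ∂σ := by
  classical
  have hQ : ∀ i, MeasurableSet (gridCube o i) := fun i => measurableSet_cube _ _
  set w : ℤ × (Fin n → ℤ) → ℝ≥0∞ :=
    fun i => (σ.withDensity g (gridCube o i) / volume (gridCube o i)) ^ 2 with hw
  set sz : ℤ × (Fin n → ℤ) → ℝ≥0∞ := fun i => σ (cube (gridCenter o i) (Γ * side i.1)) with hsz
  have hσ : ∀ i, σ (gridCube o i) ≤ sz i := fun i =>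
    measure_mono (Nested.of_le _ (le_mul_of_one_le_left (side_pos _).le hΓ.le)).subset
  have hszt : ∀ i, sz i ≠ ∞ := fun i => measure_cube_ne_top σ _ _
  obtain ⟨E, hE, hEQ, hd, hmax⟩ := exists_disjoint_linearization s (gridCube o) hQ w
  have hpt : ∀ x, (s.sup fun i => (gridCube o i).indicator (fun _ => w i) x) ≤
      ∑ i ∈ s, (E i).indicator (fun _ => w i) x := by
    refine fun x => Finset.sup_le fun i hi => ?_
    by_cases hx : x ∈ gridCube o i
    · obtain ⟨j, hj, hxj, hij⟩ := hmax x i hi hx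
      refine le_trans ?_ (Finset.single_le_sum (f := fun i => (E i).indicator (fun _ => w i) x)
        (fun _ _ => zero_le) hj)
      simpa [hx, hxj] using hij
    · simp [hx]
  have hwe : ∀ i, w i = (sz i / volume (gridCube o i)) ^ 2 *
      ((∫⁻ x in gridCube o i, g x ∂σ) / sz i) ^ 2 := by
    intro i
    simp only [hw]
    rw [withDensity_apply _ (hQ i), ← mul_pow]
    congr 1
    -- if `σ (ΓQ) = 0`, both sides vanish, with `0 / 0 = 0` on the right
    rcases eq_or_ne (sz i) 0 with h | h
    · have : σ (gridCube o i) = 0 := le_antisymm ((hσ i).trans h.le) zero_le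
      simp [h, Measure.restrict_eq_zero.2 this]
    · calc _ = sz i / sz i * ((∫⁻ x in gridCube o i, g x ∂σ) / volume (gridCube o i)) := by
            rw [ENNReal.div_self h (hszt i), one_mul]
        _ = _ := by simp only [div_eq_mul_inv]; ring
  calc _ ≤ ∫⁻ x, ∑ i ∈ s, (E i).indicator (fun _ => w i) x ∂ω' := lintegral_mono hpt
    _ = ∑ i ∈ s, ω' (E i) * (sz i / volume (gridCube o i)) ^ 2 *
        ((∫⁻ x in gridCube o i, g x ∂σ) / sz i) ^ 2 := by
      rw [lintegral_finsetSum _ fun i _ => measurable_const.indicator (hE i)]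
      refine Finset.sum_congr rfl fun i _ => ?_
      rw [lintegral_indicator_const (hE i), hwe i]
      ring
    _ ≤ _ := carleson_embedding σ g hg hg2 s (gridCube o) hQ (GridLE o)
      (fun i => Nested.of_le _ le_rfl) (fun _ _ _ => Nested.trans) (fun _ _ => Nested.subset)
      ho.le_or_le_or_disjoint _ sz hszt hσ _ fun F _ =>
        carleson_condition hω hΓ hD hu hv ho hK hT _ E hE hEQ
          (hd.subset (Finset.coe_subset.2 (Finset.filter_subset _ _)))
          (fun i hi => hs i (Finset.mem_filter.1 hi).1) F
          fun i hi => (Finset.mem_filter.1 hi).2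

/-- Every average over a dyadic-sided cube is dominated by averages over the cubes of the adjacent
grids. -/
lemma average_sq_le (τ : ℝ) (μ : Measure (Fin n → ℝ)) {x c : Fin n → ℝ} {p : ℤ → Prop}
    {k : ℤ} (hp : p (k + 2)) (hx : x ∈ cube c (side k)) :
    (μ (cube c (side k)) / volume (cube c (side k))) ^ 2 ≤ 16 ^ n * ∑ e : Fin n → Bool,
      ⨆ j : {j : ℤ × (Fin n → ℤ) // p j.1}, (gridCube (shiftedGrid τ e) j.1).indicator
        (fun _ => (μ (gridCube (shiftedGrid τ e) j.1) /
          volume (gridCube (shiftedGrid τ e) j.1)) ^ 2) x := by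
  obtain ⟨e, j, hj, hsub⟩ := exists_gridCube_superset τ c k
  have hvol : volume (gridCube (shiftedGrid τ e) j) = 4 ^ n * volume (cube c (side k)) := by
    have h := side_add_nat k 2
    push_cast at h
    rw [gridCube, hj, h, volume_cube_pow_mul c, pow_mul]
    norm_num
  have h4 : (4 : ℝ≥0∞) ^ n ≠ 0 := pow_ne_zero _ (by norm_num)
  have h4' : (4 : ℝ≥0∞) ^ n ≠ ∞ := ENNReal.pow_ne_top ENNReal.ofNat_ne_top
  have h16 : (16 : ℝ≥0∞) ^ n = (4 ^ n) ^ 2 := by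
    rw [← pow_mul, mul_comm, pow_mul]
    norm_num
  calc (μ (cube c (side k)) / volume (cube c (side k))) ^ 2
      ≤ (4 ^ n * (μ (gridCube (shiftedGrid τ e) j) /
          volume (gridCube (shiftedGrid τ e) j))) ^ 2 := by
        refine pow_le_pow_left' ?_ 2
        rw [hvol, ← mul_div_assoc, ENNReal.mul_div_mul_left _ _ h4 h4']
        exact ENNReal.div_le_div_right (measure_mono hsub) _
    _ = 16 ^ n * (gridCube (shiftedGrid τ e) j).indicator
        (fun _ => (μ (gridCube (shiftedGrid τ e) j) /
          volume (gridCube (shiftedGrid τ e) j)) ^ 2) x := by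
        rw [Set.indicator_of_mem (hsub hx), mul_pow, h16]
    _ ≤ _ := by
        refine mul_le_mul_right ?_ _
        refine le_trans ?_ (Finset.single_le_sum (f := fun e : Fin n → Bool =>
          ⨆ j : {j : ℤ × (Fin n → ℤ) // p j.1}, (gridCube (shiftedGrid τ e) j.1).indicator
            (fun _ => (μ (gridCube (shiftedGrid τ e) j.1) /
            volume (gridCube (shiftedGrid τ e) j.1)) ^ 2) x) (fun _ _ => zero_le)
            (Finset.mem_univ e))
        exact le_iSup_of_le ⟨j, hj ▸ hp⟩ le_rfl

/-- Integrated form of `average_sq_le`: a bound, uniform over the finite families of cubes of the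
adjacent grids, yields a bound for the maximal function `f` over the cubes whose scale satisfies
`p`. -/
lemma lintegral_le_of_gridMax_le (τ : ℝ) (μ ω : Measure (Fin n → ℝ)) {p : ℤ → Prop}
    (hp : ∀ k, p k → p (k + 2)) {f : (Fin n → ℝ) → ℝ≥0∞}
    (hf : ∀ x L, (∀ c k, p k → x ∈ cube c (side k) →
      (μ (cube c (side k)) / volume (cube c (side k))) ^ 2 ≤ L) → f x ^ 2 ≤ L) {L : ℝ≥0∞}
    (hL : ∀ (e : Fin n → Bool) (s : Finset (ℤ × (Fin n → ℤ))), (∀ i ∈ s, p i.1) →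
      ∫⁻ x, (s.sup fun i => (gridCube (shiftedGrid τ e) i).indicator
        (fun _ => (μ (gridCube (shiftedGrid τ e) i) /
          volume (gridCube (shiftedGrid τ e) i)) ^ 2) x) ∂ω ≤ L) :
    ∫⁻ x, f x ^ 2 ∂ω ≤ 16 ^ n * (2 ^ n * L) := by
  classical
  set M : (Fin n → Bool) → (Fin n → ℝ) → ℝ≥0∞ := fun e x =>
    ⨆ j : {j : ℤ × (Fin n → ℤ) // p j.1}, (gridCube (shiftedGrid τ e) j.1).indicator
      (fun _ => (μ (gridCube (shiftedGrid τ e) j.1) /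
        volume (gridCube (shiftedGrid τ e) j.1)) ^ 2) x with hM
  have hMm : ∀ e, Measurable (M e) := fun e =>
    Measurable.iSup fun j => measurable_const.indicator (measurableSet_cube _ _)
  have hMi : ∀ e, ∫⁻ x, M e x ∂ω ≤ L := by
    intro e
    refine lintegral_iSup_indicator_sq_le ω (fun j : {j : ℤ × (Fin n → ℤ) // p j.1} =>
      gridCube (shiftedGrid τ e) j.1) (fun j => measurableSet_cube _ _) _ fun s => ?_
    have := hL e (s.map (Function.Embedding.subtype _)) (by
      intro i hi
      obtain ⟨j, -, rfl⟩ := Finset.mem_map.1 hi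
      exact j.2)
    simpa only [Finset.sup_map, Function.comp_def, Function.Embedding.subtype_apply] using this
  calc _ ≤ ∫⁻ x, 16 ^ n * ∑ e, M e x ∂ω :=
        lintegral_mono fun x => hf x _ fun c k hk hx => average_sq_le τ μ (hp k hk) hx
    _ = 16 ^ n * ∑ e, ∫⁻ x, M e x ∂ω := by
        rw [lintegral_const_mul' _ _ (ENNReal.pow_ne_top ENNReal.ofNat_ne_top),
          lintegral_finsetSum _ fun e _ => hMm e]
    _ ≤ 16 ^ n * ∑ e : Fin n → Bool, L := by
        gcongr with e
        exact hMi e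
    _ = _ := by simp

/-- Absorption: a bound that reproduces itself with a factor `1 / 2` can be removed. -/
lemma truncatedBound_of_half {σ ω : Measure (Fin n → ℝ)} {K₀ : ℤ} {A K : ℝ≥0∞}
    (hKt : K ≠ ∞) (hK : TruncatedBound σ ω K₀ K)
    (h : ∀ K, TruncatedBound σ ω K₀ K → TruncatedBound σ ω K₀ (A + K / 2)) :
    TruncatedBound σ ω K₀ (2 * A) := by
  have hit : ∀ m : ℕ, TruncatedBound σ ω K₀ (2 * A + K * 2⁻¹ ^ m) := by
    intro m
    induction m with
    | zero =>
      intro g hg hg2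
      refine (hK g hg hg2).trans ?_
      gcongr
      simp
    | succ m ih =>
      have e : A + (2 * A + K * 2⁻¹ ^ m) / 2 = 2 * A + K * 2⁻¹ ^ (m + 1) := by
        rw [ENNReal.add_div, mul_comm 2 A, ENNReal.mul_div_cancel_right two_ne_zero
          ENNReal.ofNat_ne_top, pow_succ, div_eq_mul_inv]
        ring
      exact e ▸ h _ ih
  intro g hg hg2
  have hlim : Filter.Tendsto (fun m : ℕ => (2 * A + K * 2⁻¹ ^ m) * ∫⁻ x, g x ^ 2 ∂σ)
      Filter.atTop (nhds ((2 * A + K * 0) * ∫⁻ x, g x ^ 2 ∂σ)) := by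
    refine ENNReal.Tendsto.mul_const (tendsto_const_nhds.add ?_) (Or.inr hg2)
    exact ENNReal.Tendsto.const_mul (ENNReal.tendsto_pow_atTop_nhds_zero_of_lt_one (by simp))
      (Or.inr hKt)
  rw [mul_zero, add_zero] at hlim
  exact ge_of_tendsto' hlim fun m => hit m g hg hg2

/-- Every finite family of grid cubes lies in a bounded dyadic-sided cube. -/
lemma exists_cube_superset (o : ℤ → Fin n → ℝ) (s : Finset (ℤ × (Fin n → ℤ))) :
    ∃ M : ℤ, ∀ i ∈ s, gridCube o i ⊆ cube 0 (side M) := by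
  have h1 : ∀ i : ℤ × (Fin n → ℤ), ∃ M : ℕ, gridCube o i ⊆ cube 0 (side M) := by
    intro i
    obtain ⟨M, hM⟩ := pow_unbounded_of_one_lt (2 * ∑ l, |gridCenter o i l| + side i.1)
      one_lt_two
    refine ⟨M, Nested.subset ⟨?_, fun l => ?_⟩⟩
    · have : 0 ≤ ∑ l, |gridCenter o i l| := Finset.sum_nonneg fun _ _ => abs_nonneg _
      rw [side, side, zpow_natCast]
      rw [side] at hM
      linarith
    · have : |gridCenter o i l| ≤ ∑ l, |gridCenter o i l| :=
        Finset.single_le_sum (f := fun l => |gridCenter o i l|) (fun _ _ => abs_nonneg _)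
          (Finset.mem_univ l)
      have hsM : side (M : ℤ) = 2 ^ M := by rw [side, zpow_natCast]
      rw [Pi.zero_apply, sub_zero, hsM]
      linarith
  choose M hM using h1
  refine ⟨(s.sup M : ℕ), fun i hi => (hM i).trans (Nested.of_le _ (side_mono ?_)).subset⟩
  exact_mod_cast Finset.le_sup hi

/-- **Sufficiency of restricted testing and `A₂`**, with the testing inequality only for cubes with
null boundary. The doubling constant `D = 2 * c` leaves a factor `1 / 2` in the absorption. -/
theorem lintegral_maximal_sq_le {Γ : ℝ} (hΓ : 1 < Γ) {u v : ℕ} (hu : Γ ≤ 2 ^ u * (Γ - 1))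
    (hv : Γ ≤ 2 ^ v) {c : ℝ≥0} (hc : c = 16 ^ n * (2 ^ n * (4 * (4 ^ ((u + v) * n) * 4 ^ (v * n)))))
    (hc1 : 1 ≤ c) (σ ω : Measure (Fin n → ℝ)) [IsLocallyFiniteMeasure σ] [IsLocallyFiniteMeasure ω]
    (hA : muckenhoupt σ ω ≠ ∞) {T : ℝ≥0∞}
    (hT : ∀ (a : Fin n → ℝ) (k : ℤ), (σ + ω) (frontier (cube a (side k))) = 0 →
      σ (cube a (Γ * side k)) ≤ ENNReal.ofReal (2 * c : ℝ≥0) * σ (cube a (side k)) →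
      ∫⁻ x in cube a (side k), maximal (σ.restrict (cube a (side k))) x ^ 2 ∂ω
        ≤ T ^ 2 * σ (cube a (side k)))
    (g : (Fin n → ℝ) → ℝ≥0∞) (hg : Measurable g) (hg2 : ∫⁻ x, g x ^ 2 ∂σ ≠ ∞) :
    ∫⁻ x, maximal (σ.withDensity g) x ^ 2 ∂ω ≤
      16 ^ n * (2 ^ n * (2 * (c * (T ^ 2 + muckenhoupt σ ω)) * ∫⁻ x, g x ^ 2 ∂σ)) := by
  classical
  obtain ⟨τ, hτ⟩ := exists_translation_frontier_null (σ + ω)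
  have hc0 : (c : ℝ≥0∞) ≠ 0 := by exact_mod_cast (zero_lt_one.trans_le hc1).ne'
  have hcE : (c : ℝ≥0∞) = 16 ^ n * (2 ^ n * (4 * (4 ^ ((u + v) * n) * 4 ^ (v * n)))) := by
    rw [hc]
    push_cast
    rfl
  have hD : ENNReal.ofReal (2 * c : ℝ≥0) = 2 * c := by
    rw [ENNReal.ofReal_coe_nnreal]
    push_cast
    rfl
  have hfinal : ∀ K₀ M : ℤ, TruncatedBound σ (ω.restrict (cube 0 (side M))) K₀
      (2 * (c * (T ^ 2 + muckenhoupt σ ω))) := by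
    intro K₀ M
    obtain ⟨K, hKt, hK⟩ := exists_truncatedBound σ ω hA K₀ M
    refine truncatedBound_of_half hKt hK fun K hK g hg hg2 => ?_
    refine (lintegral_le_of_gridMax_le τ _ _ (p := fun k => K₀ ≤ k)
      (fun k hk => by omega) (fun x L h => maximalFrom_sq_le h) fun e s hs =>
        lintegral_gridMax_le (σ := σ) (ω := ω) Measure.restrict_le_self hΓ
          (D := (2 * c : ℝ≥0)) (by positivity) hu hv (isGrid_shiftedGrid τ e) hK
          (fun j k => hT _ k (hτ e j k)) g hg hg2 s hs).trans (le_of_eq ?_)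
    have hKc : (c : ℝ≥0∞) * (K / (2 * c)) = K / 2 := by
      rw [mul_comm (2 : ℝ≥0∞), ← mul_div_assoc, ENNReal.mul_div_mul_left _ _ hc0
        ENNReal.coe_ne_top]
    rw [hD, ← hKc]
    calc _ = 16 ^ n * (2 ^ n * (4 * (4 ^ ((u + v) * n) * 4 ^ (v * n)))) *
          (T ^ 2 + muckenhoupt σ ω + K / (2 * c)) * ∫⁻ x, g x ^ 2 ∂σ := by ring
      _ = _ := by rw [← hcE]; ring
  refine lintegral_le_of_gridMax_le τ _ _ (p := fun _ => True) (fun _ _ => trivial)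
    (fun x L h => maximal_sq_le fun c k hx => h c k trivial hx) fun e s _ => ?_
  -- a finite family of cubes is bounded and has a smallest scale
  obtain ⟨M, hM⟩ := exists_cube_superset (shiftedGrid τ e) s
  obtain ⟨K₀, hK₀⟩ := (s.image Prod.fst).bddBelow
  refine le_trans ?_ (hfinal K₀ M g hg hg2)
  rw [← lintegral_indicator (measurableSet_cube _ _)]
  refine lintegral_mono fun x => Finset.sup_le fun i hi => ?_
  by_cases hx : x ∈ gridCube (shiftedGrid τ e) i
  · rw [Set.indicator_of_mem hx, Set.indicator_of_mem (hM i hi hx)]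
    exact pow_le_pow_left' (le_maximalFrom
      (hK₀ (Finset.mem_coe.2 (Finset.mem_image_of_mem _ hi))) hx) 2
  · simp [hx]

/-! ### Necessity and the comparison of the constants -/

lemma lintegral_sq_le_of_forall_operatorNorm {σ ω : Measure (Fin n → ℝ)} [IsLocallyFiniteMeasure σ]
    {N : ℝ≥0∞} (hN : ∀ f : (Fin n → ℝ) → ℝ, MemLp f 2 σ →
      ∫⁻ x, maximal (totalVar f σ) x ^ 2 ∂ω ≤ N ^ 2 * ∫⁻ x, ‖f x‖ₑ ^ 2 ∂σ)
    (c : Fin n → ℝ) (k : ℤ) :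
    ∫⁻ x in cube c (side k), maximal (σ.restrict (cube c (side k))) x ^ 2 ∂ω ≤
      N ^ 2 * σ (cube c (side k)) := by
  have hm := measurableSet_cube c (side k)
  have he : (fun x => ‖(cube c (side k)).indicator (fun _ => (1 : ℝ)) x‖ₑ) =
      (cube c (side k)).indicator 1 := by
    ext x
    by_cases hx : x ∈ cube c (side k) <;> simp [hx]
  have h := hN ((cube c (side k)).indicator fun _ => 1)
    (memLp_indicator_const 2 hm 1 (Or.inr (measure_cube_ne_top σ c _)))
  have h2 : ∫⁻ x, ‖(cube c (side k)).indicator (fun _ => (1 : ℝ)) x‖ₑ ^ 2 ∂σ =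
      σ (cube c (side k)) := by
    rw [← lintegral_indicator_one hm]
    refine lintegral_congr fun x => ?_
    by_cases hx : x ∈ cube c (side k) <;> simp [hx]
  rw [totalVar, he, withDensity_indicator_one hm, h2] at h
  exact (setLIntegral_le_lintegral _ _).trans h

lemma testing_le_operatorNorm (D Γ : ℝ) (σ ω : Measure (Fin n → ℝ)) [IsLocallyFiniteMeasure σ] :
    testing D Γ σ ω ≤ operatorNorm σ ω :=
  le_sInf fun _ hN => sInf_le fun c k _ => lintegral_sq_le_of_forall_operatorNorm hN c k

lemma testingNull_le_testing (D Γ : ℝ) (σ ω : Measure (Fin n → ℝ)) :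
    testingNull D Γ σ ω ≤ testing D Γ σ ω :=
  sInf_le_sInf fun _ hT c k _ hd => hT c k hd

/-- `A₂` is necessary: on `Q` the maximal function of `1_Q σ` is at least the average of `σ`. -/
lemma muckenhoupt_rpow_le_operatorNorm (σ ω : Measure (Fin n → ℝ)) [IsLocallyFiniteMeasure σ] :
    muckenhoupt σ ω ^ (1 / 2 : ℝ) ≤ operatorNorm σ ω := by
  refine le_sInf fun N hN => ?_
  have hA : muckenhoupt σ ω ≤ N ^ 2 := by
    refine iSup_le fun c => iSup_le fun k => ?_
    have h := lintegral_sq_le_of_forall_operatorNorm hN c k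
    set Q := cube c (side k) with hQ
    have hv : volume Q ≠ 0 := volume_cube_ne_zero c (side_pos k)
    have hv' : volume Q ≠ ∞ := volume_cube_ne_top c _
    have hσt : σ Q ≠ ∞ := measure_cube_ne_top σ c _
    rcases eq_or_ne (σ Q) 0 with h0 | h0
    · simp [h0]
    have h1 : (σ Q / volume Q) ^ 2 * ω Q ≤ N ^ 2 * σ Q := by
      refine le_trans ?_ h
      rw [← setLIntegral_const]
      refine setLIntegral_mono' (measurableSet_cube _ _) fun x hx => ?_
      have := le_maximal (μ := σ.restrict Q) hx
      rw [← hQ, Measure.restrict_apply_self] at this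
      exact pow_le_pow_left' this 2
    rw [← ENNReal.mul_le_mul_iff_left h0 hσt]
    refine le_trans (le_of_eq ?_) h1
    simp only [div_eq_mul_inv]
    ring
  calc _ ≤ (N ^ 2) ^ (1 / 2 : ℝ) := by gcongr
    _ = N := by rw [← ENNReal.rpow_natCast, ← ENNReal.rpow_mul]; simp

lemma le_mul_sInf_add {S : Set ℝ≥0∞} {x a c : ℝ≥0∞} (hc : c ≠ 0) (hc' : c ≠ ∞)
    (h : ∀ t ∈ S, x ≤ c * (t + a)) : x ≤ c * (sInf S + a) := by
  rw [mul_comm, ← ENNReal.div_le_iff hc hc', ENNReal.sInf_add]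
  exact le_iInf₂ fun t ht => by
    rw [ENNReal.div_le_iff hc hc', mul_comm]
    exact h t ht

/-- The upper bound for the operator norm by the testing constant for cubes with null boundary. -/
lemma operatorNorm_le {Γ : ℝ} (hΓ : 1 < Γ) {u v : ℕ} (hu : Γ ≤ 2 ^ u * (Γ - 1))
    (hv : Γ ≤ 2 ^ v) {c : ℝ≥0} (hc : c = 16 ^ n * (2 ^ n * (4 * (4 ^ ((u + v) * n) * 4 ^ (v * n)))))
    (hc1 : 1 ≤ c)
    (σ ω : Measure (Fin n → ℝ)) [IsLocallyFiniteMeasure σ] [IsLocallyFiniteMeasure ω] :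
    operatorNorm σ ω ≤ (16 ^ n * (2 ^ n * (2 * c)) : ℝ≥0) *
      (testingNull (2 * c : ℝ≥0) Γ σ ω + muckenhoupt σ ω ^ (1 / 2 : ℝ)) := by
  set C : ℝ≥0 := 16 ^ n * (2 ^ n * (2 * c)) with hC
  have hc0 : 0 < c := zero_lt_one.trans_le hc1
  have hC1 : 1 ≤ C := by
    have h16 : (1 : ℝ≥0) ≤ 16 ^ n := one_le_pow₀ (by norm_num)
    have h2 : (1 : ℝ≥0) ≤ 2 ^ n := one_le_pow₀ (by norm_num)
    exact one_le_mul_of_one_le_of_one_le h16 (one_le_mul_of_one_le_of_one_le h2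
      (one_le_mul_of_one_le_of_one_le one_le_two hc1))
  have hC0 : (C : ℝ≥0∞) ≠ 0 := by exact_mod_cast (zero_lt_one.trans_le hC1).ne'
  rcases eq_or_ne (muckenhoupt σ ω) ∞ with hA | hA
  · rw [hA, ENNReal.top_rpow_of_pos (by norm_num), add_top, ENNReal.mul_top hC0]
    exact le_top
  refine le_mul_sInf_add hC0 ENNReal.coe_ne_top fun T hT => sInf_le fun f hf => ?_
  set a := muckenhoupt σ ω ^ (1 / 2 : ℝ) with ha
  have ha2 : a ^ 2 = muckenhoupt σ ω := rpow_half_sq _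
  -- replace `|f|` by a measurable representative
  have hfm : AEMeasurable (fun x => ‖f x‖ₑ) σ := hf.1.enorm
  have hgf : ∫⁻ x, hfm.mk _ x ^ 2 ∂σ = ∫⁻ x, ‖f x‖ₑ ^ 2 ∂σ :=
    lintegral_congr_ae (hfm.ae_eq_mk.symm.fun_comp (· ^ 2))
  have hf2 : ∫⁻ x, ‖f x‖ₑ ^ 2 ∂σ ≠ ∞ := by
    have := lintegral_rpow_enorm_lt_top_of_eLpNorm_lt_top two_ne_zero ENNReal.ofNat_ne_top hf.2
    simpa using this.ne
  have h := lintegral_maximal_sq_le hΓ hu hv hc hc1 σ ω hA (fun c k => hT c k) (hfm.mk _)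
    hfm.measurable_mk (hgf ▸ hf2)
  rw [← withDensity_congr_ae hfm.ae_eq_mk, hgf] at h
  refine h.trans ?_
  calc _ = C * (T ^ 2 + a ^ 2) * ∫⁻ x, ‖f x‖ₑ ^ 2 ∂σ := by
        rw [ha2, hC]
        push_cast
        ring
    _ ≤ C ^ 2 * (T + a) ^ 2 * ∫⁻ x, ‖f x‖ₑ ^ 2 ∂σ := by
        gcongr
        · exact_mod_cast le_self_pow hC1 two_ne_zero
        · calc T ^ 2 + a ^ 2 ≤ T ^ 2 + a ^ 2 + 2 * T * a := le_self_add
            _ = _ := by ring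
    _ = _ := by rw [mul_pow]

end RestrictedTesting

theorem theorem1 (n : ℕ) (Γ : ℝ) (hΓ : 1 < Γ) :
    ∃ D : ℝ, 1 < D ∧ ∃ C : ℝ≥0,
      ∀ (σ ω : Measure (Fin n → ℝ)) [IsLocallyFiniteMeasure σ] [IsLocallyFiniteMeasure ω],
        (RestrictedTesting.operatorNorm σ ω ≤
            C * (RestrictedTesting.testing D Γ σ ω +
              RestrictedTesting.muckenhoupt σ ω ^ (1 / 2 : ℝ)) ∧
          RestrictedTesting.testing D Γ σ ω +
              RestrictedTesting.muckenhoupt σ ω ^ (1 / 2 : ℝ) ≤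
            C * RestrictedTesting.operatorNorm σ ω) ∧
        (RestrictedTesting.operatorNorm σ ω ≤
            C * (RestrictedTesting.testingNull D Γ σ ω +
              RestrictedTesting.muckenhoupt σ ω ^ (1 / 2 : ℝ)) ∧
          RestrictedTesting.testingNull D Γ σ ω +
              RestrictedTesting.muckenhoupt σ ω ^ (1 / 2 : ℝ) ≤
            C * RestrictedTesting.operatorNorm σ ω) := by
  -- `2 ^ v` bounds the dilation; `2 ^ (-u)` times the side of `F` is the side of a testing cube,
  -- small enough for its `Γ`-dilate to stay inside `ΓF` whenever its centre is in `F`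
  obtain ⟨v, hv⟩ := pow_unbounded_of_one_lt Γ one_lt_two
  obtain ⟨u, hu⟩ := pow_unbounded_of_one_lt (Γ / (Γ - 1)) one_lt_two
  rw [div_lt_iff₀ (by linarith)] at hu
  set c : ℝ≥0 := 16 ^ n * (2 ^ n * (4 * (4 ^ ((u + v) * n) * 4 ^ (v * n)))) with hc
  have hc1 : 1 ≤ c := by
    rw [hc]
    exact_mod_cast Nat.one_le_iff_ne_zero.2 (by positivity)
  have hc1' : (1 : ℝ) ≤ c := by exact_mod_cast hc1
  have h2c : (2 : ℝ≥0) ≤ 16 ^ n * (2 ^ n * (2 * c)) := by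
    calc (2 : ℝ≥0) = 1 * (1 * (2 * 1)) := by norm_num
      _ ≤ _ := by
        gcongr
        · exact one_le_pow₀ (by norm_num)
        · exact one_le_pow₀ (by norm_num)
  refine ⟨(2 * c : ℝ≥0), by push_cast; linarith, 16 ^ n * (2 ^ n * (2 * c)), ?_⟩
  intro σ ω _ _
  have hup := RestrictedTesting.operatorNorm_le hΓ hu.le hv.le hc hc1 σ ω
  have hTT := RestrictedTesting.testingNull_le_testing (2 * c : ℝ≥0) Γ σ ω
  have hT := RestrictedTesting.testing_le_operatorNorm (2 * c : ℝ≥0) Γ σ ω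
  have hA := RestrictedTesting.muckenhoupt_rpow_le_operatorNorm σ ω
  have hlow : RestrictedTesting.testing (2 * c : ℝ≥0) Γ σ ω +
      RestrictedTesting.muckenhoupt σ ω ^ (1 / 2 : ℝ) ≤
      (16 ^ n * (2 ^ n * (2 * c)) : ℝ≥0) * RestrictedTesting.operatorNorm σ ω :=
    calc _ ≤ 2 * RestrictedTesting.operatorNorm σ ω := by
          exact (add_le_add hT hA).trans_eq (two_mul _).symm
      _ ≤ _ := by
          gcongr
          exact_mod_cast h2c
  exact ⟨⟨hup.trans (by gcongr), hlow⟩, hup, le_trans (by gcongr) hlow⟩
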